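/- Let $M$ be a II$_1$ factor with faithful normal tracial state $\tau$, and write $\|x\|_2=\tau(x^*x)^{1/2}$. Let $A\subset M$ be an abelian von Neumann subalgebra (with the same unit), and let $E_A:M\to A$ be the unique $\tau$-preserving conditional expectation. (1) Suppose that $A$ is diffuse, i.e. has no minimal projections. Let $\varepsilon>0$ and let $n$ be a nonnegative integer with $n<\varepsilon^{-2}$. Then there exists a self-adjoint unitary $x\in M$ with $E_A(x)=0$ such that $$\Bigl\|\sum_{k=1}^n p_kxp_k\Bigr\|\ \ge\ \Bigl\|\sum_{k=1}^n p_kxp_k\Bigr\|_2\ >\ \varepsilon$$ for every decomposition of the identity $1=p_1+\cdots+p_n$ with $n$ projections $p_k\in A$. (2) Suppose that $A$ is a MASA (maximal abelian $*$-subalgebra) of $M$. Let $\omega$ be a free ultrafilter on $\mathbb N$, let $M^\omega=\ell^\infty(\mathbb N,M)/\{(x_m)_m : \lim_{m\to\omega}\|x_m\|_2=0\}$ be the tracial ultrapower with trace $\tau_\omega((x_m)_m)=\lim_{m\to\omega}\tau(x_m)$ and the corresponding norm $\|\cdot\|_2$, let $A^\omega\subset M^\omega$ be the subalgebra of the classes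 of bounded sequences in $A$, and let $E_{A^\omega}:M^\omega\to A^\omega$ be the unique $\tau_\omega$-preserving conditional expectation. Then for every $\varepsilon>0$ the uniform $L^2$-paving size of $A^\omega\subset M^\omega$ is exactly $\lceil\varepsilon^{-2}\rceil$: this is the least integer $n$ such that for every $x\in M^\omega$ with $E_{A^\omega}(x)=0$ there are projections $p_1,\dots,p_n\in A^\omega$ with $\sum_k p_k=1$ and $\|\sum_k p_kxp_k\|_2\le\varepsilon\|x\|_2$. The least such integer is the same if one only considers self-adjoint $x$. (The existence of the conditional expectations $E_A$ in (1) and $E_{A^\omega}$ in (2) is part of the assertion.) -/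

import Mathlib

open Filter Topology

namespace Paving

/-! ## Von Neumann algebras as C*-algebras -/

section VonNeumann

variable {H : Type*} [NormedAddCommGroup H] [InnerProductSpace ℂ H] [CompleteSpace H]

/-- A von Neumann algebra is norm closed, since it is a commutant. -/
instance isClosed_toStarSubalgebra (M : VonNeumannAlgebra H) :
    IsClosed (M.toStarSubalgebra : Set (H →L[ℂ] H)) := by
  rw [VonNeumannAlgebra.coe_toStarSubalgebra, ← VonNeumannAlgebra.commutant_commutant M,
    VonNeumannAlgebra.coe_commutant]
  exact Set.isClosed_centralizer _

/-- The carrier of a von Neumann algebra, with its operator norm, as a C*-algebra. -/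
noncomputable instance cstarAlgebra (M : VonNeumannAlgebra H) :
    CStarAlgebra M.toStarSubalgebra :=
  StarSubalgebra.cstarAlgebra M.toStarSubalgebra

/-- A von Neumann algebra `A` on the same Hilbert space as `M`, viewed as a `*`-subalgebra of `M`.
It is only used when `A ≤ M`. -/
noncomputable def subalgebraOf (M A : VonNeumannAlgebra H) : StarSubalgebra ℂ M.toStarSubalgebra :=
  A.toStarSubalgebra.comap M.toStarSubalgebra.subtype

/-- A normal functional on `M`: one that is continuous for the ultraweak (`σ`-weak) topology,
i.e. of the form `x ↦ ∑ₖ ⟨ξₖ, x ηₖ⟩` with square summable sequences `ξ`, `η` in `H`. -/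
def IsNormalFunctional (M : VonNeumannAlgebra H) (τ : M.toStarSubalgebra →ₗ[ℂ] ℂ) : Prop :=
  ∃ ξ η : ℕ → H, (Summable fun k => ‖ξ k‖ ^ 2) ∧ (Summable fun k => ‖η k‖ ^ 2) ∧
    ∀ x : M.toStarSubalgebra,
      HasSum (fun k => inner ℂ (ξ k) ((x : H →L[ℂ] H) (η k))) (τ x)

/-- Commutativity of a von Neumann algebra. -/
def IsAbelian (A : VonNeumannAlgebra H) : Prop :=
  ∀ x ∈ A, ∀ y ∈ A, x * y = y * x

/-- An abelian von Neumann algebra `A` is diffuse if it has no minimal projections: each non-zero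
projection of `A` strictly dominates some non-zero projection of `A`. -/
def IsDiffuse (A : VonNeumannAlgebra H) : Prop :=
  ∀ p ∈ A, IsStarProjection p → p ≠ 0 →
    ∃ q ∈ A, IsStarProjection q ∧ q ≠ 0 ∧ q ≠ p ∧ p * q = q

/-- `A` is a MASA (maximal abelian `*`-subalgebra) of `M`: it is abelian, contained in `M`, and
is not properly contained in an abelian `*`-subalgebra of `M`. -/
structure IsMASA (M A : VonNeumannAlgebra H) : Prop where
  le : A ≤ M
  abelian : IsAbelian A
  maximal : ∀ B : StarSubalgebra ℂ (H →L[ℂ] H), (∀ x ∈ B, x ∈ M) →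
    (∀ x ∈ B, ∀ y ∈ B, x * y = y * x) → (∀ x ∈ A, x ∈ B) → ∀ x ∈ B, x ∈ A

end VonNeumann

/-! ## Traces, the 2-norm and conditional expectations -/

section Trace

variable {N : Type*} [Ring N] [StarRing N] [Algebra ℂ N]

/-- The seminorm `‖x‖₂ = τ(x* x)^{1/2}` of a positive functional `τ`. -/
noncomputable def l2Norm (τ : N →ₗ[ℂ] ℂ) (x : N) : ℝ :=
  √(τ (star x * x)).re

/-- A faithful tracial state. -/
structure IsFaithfulTracialState (τ : N →ₗ[ℂ] ℂ) : Prop where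
  nonneg_re : ∀ x, 0 ≤ (τ (star x * x)).re
  nonneg_im : ∀ x, (τ (star x * x)).im = 0
  map_one : τ 1 = 1
  tracial : ∀ x y, τ (x * y) = τ (y * x)
  faithful : ∀ x, τ (star x * x) = 0 → x = 0

variable [StarModule ℂ N]

/-- `E` is a `τ`-preserving conditional expectation of `N` onto the `*`-subalgebra `B`: a
`B`-bimodular linear projection onto `B` that preserves `τ`. Since `τ(E(x) b) = τ(x b)` for `b` in
`B`, there is at most one such map when `τ` is faithful. -/
structure IsCondExp (τ : N →ₗ[ℂ] ℂ) (B : StarSubalgebra ℂ N) (E : N →ₗ[ℂ] N) : Prop where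
  mem : ∀ x, E x ∈ B
  id_on : ∀ b ∈ B, E b = b
  bimodular : ∀ b ∈ B, ∀ c ∈ B, ∀ x, E (b * x * c) = b * E x * c
  trace_preserving : ∀ x, τ (E x) = τ x

open Classical in
/-- The `τ`-preserving conditional expectation of `N` onto `B` (the zero map if there is none). -/
noncomputable def condExp (τ : N →ₗ[ℂ] ℂ) (B : StarSubalgebra ℂ N) : N →ₗ[ℂ] N :=
  if h : ∃ E, IsCondExp τ B E then h.choose else 0

/-- A decomposition of the identity `1 = p₁ + ⋯ + pₙ` with `n` projections of `B`. -/
structure IsPartition (B : StarSubalgebra ℂ N) {n : ℕ} (p : Fin n → N) : Prop where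
  isStarProjection : ∀ k, IsStarProjection (p k)
  mem : ∀ k, p k ∈ B
  sum_eq_one : ∑ k, p k = 1

/-- An element `x` (of zero expectation onto `B`) can be `(ε, n)` `L²`-paved over `B`. -/
def IsL2Pavable (τ : N →ₗ[ℂ] ℂ) (B : StarSubalgebra ℂ N) (ε : ℝ) (n : ℕ) (x : N) : Prop :=
  ∃ p : Fin n → N, IsPartition B p ∧ l2Norm τ (∑ k, p k * x * p k) ≤ ε * l2Norm τ x

/-- `n` is the uniform `L²`-paving size of `B ⊂ N` for elements in the class `S`: the least integer
such that all elements of `S` with zero expectation onto `B` can be `(ε, n)` `L²`-paved. -/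
def IsUniformL2PavingSize (τ : N →ₗ[ℂ] ℂ) (B : StarSubalgebra ℂ N) (S : Set N) (ε : ℝ)
    (n : ℕ) : Prop :=
  IsLeast {m : ℕ | ∀ x ∈ S, condExp τ B x = 0 → IsL2Pavable τ B ε m x} n

end Trace

/-- A `II₁` factor: an infinite dimensional von Neumann algebra with trivial center that has a
faithful normal tracial state. -/
structure IsIIOneFactor {H : Type*} [NormedAddCommGroup H] [InnerProductSpace ℂ H]
    [CompleteSpace H] (M : VonNeumannAlgebra H) : Prop where
  factor : ∀ x ∈ M, (∀ y ∈ M, x * y = y * x) → ∃ c : ℂ, x = c • 1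
  infinite_dim : ¬ FiniteDimensional ℂ M.toStarSubalgebra
  finite : ∃ τ : M.toStarSubalgebra →ₗ[ℂ] ℂ,
    IsFaithfulTracialState τ ∧ IsNormalFunctional M τ

/-! ## The tracial ultrapower -/

section Ultrapower

variable {N : Type*} [CStarAlgebra N] {τ : N →ₗ[ℂ] ℂ}

theorem IsFaithfulTracialState.star_left (hτ : IsFaithfulTracialState τ) (x : N) :
    τ (star x) = star (τ x) := by
  have h0 := hτ.nonneg_im 1
  have h1 := hτ.nonneg_im x
  have h2 := hτ.nonneg_im (1 + x)
  have h3 := hτ.nonneg_im (1 + Complex.I • x)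
  simp only [star_add, star_one, add_mul, mul_add, one_mul, mul_one, map_add, star_smul,
    smul_mul_assoc, mul_smul_comm, map_smul, smul_eq_mul, Complex.add_im, Complex.mul_im,
    Complex.I_re, Complex.I_im, Complex.star_def, Complex.conj_I, Complex.neg_re, Complex.neg_im,
    Complex.mul_re] at h0 h1 h2 h3
  apply Complex.ext
  · simp only [Complex.star_def, Complex.conj_re]
    linarith
  · simp only [Complex.star_def, Complex.conj_im]
    linarith

theorem IsFaithfulTracialState.norm_sq_le (hτ : IsFaithfulTracialState τ) (x : N) :
    ‖τ x‖ ^ 2 ≤ (τ (star x * x)).re := by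
  have h := hτ.nonneg_re (x - τ x • 1)
  simp only [star_sub, star_smul, star_one, sub_mul, mul_sub, smul_mul_assoc, mul_smul_comm,
    one_mul, mul_one, map_sub, map_smul, smul_eq_mul, hτ.map_one, hτ.star_left] at h
  rw [Complex.sq_norm, Complex.normSq_apply]
  simp only [Complex.star_def, Complex.sub_re, Complex.mul_re, Complex.conj_re,
    Complex.conj_im] at h
  linarith

theorem IsFaithfulTracialState.mul_left_le (hτ : IsFaithfulTracialState τ) (x y : N) :
    (τ (star (x * y) * (x * y))).re ≤ ‖x‖ ^ 2 * (τ (star y * y)).re := by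
  let _ := CStarAlgebra.spectralOrder N
  have _ := CStarAlgebra.spectralOrderedRing N
  have h : star x * x ≤ algebraMap ℝ N (‖x‖ ^ 2) := CStarAlgebra.star_mul_le_algebraMap_norm_sq
  obtain ⟨z, hz⟩ := CStarAlgebra.nonneg_iff_eq_star_mul_self.mp (sub_nonneg.mpr h)
  have h1 := hτ.nonneg_re (z * y)
  have h2 : star (z * y) * (z * y)
      = ((‖x‖ ^ 2 : ℝ) : ℂ) • (star y * y) - star (x * y) * (x * y) := by
    have h3 : star (z * y) * (z * y) = star y * (star z * z) * y := by
      simp only [star_mul, mul_assoc]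
    rw [h3, ← hz, Algebra.algebraMap_eq_smul_one, mul_sub, sub_mul, mul_smul_comm,
      smul_mul_assoc, mul_one, Complex.coe_smul]
    simp only [star_mul, mul_assoc]
  rw [h2, map_sub, map_smul, Complex.sub_re, smul_eq_mul, Complex.re_ofReal_mul] at h1
  linarith

theorem IsFaithfulTracialState.star_swap (hτ : IsFaithfulTracialState τ) (x : N) :
    l2Norm τ (star x) = l2Norm τ x := by
  rw [l2Norm, l2Norm, star_star, hτ.tracial]

theorem IsFaithfulTracialState.l2Norm_mul_left (hτ : IsFaithfulTracialState τ) (x y : N) :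
    l2Norm τ (x * y) ≤ ‖x‖ * l2Norm τ y := by
  rw [l2Norm, l2Norm]
  refine (Real.sqrt_le_sqrt (hτ.mul_left_le x y)).trans ?_
  rw [Real.sqrt_mul (sq_nonneg _), Real.sqrt_sq (norm_nonneg _)]

theorem IsFaithfulTracialState.l2Norm_mul_right (hτ : IsFaithfulTracialState τ) (x y : N) :
    l2Norm τ (x * y) ≤ ‖y‖ * l2Norm τ x := by
  rw [← hτ.star_swap, star_mul, ← hτ.star_swap x, ← norm_star y]
  exact hτ.l2Norm_mul_left _ _

theorem IsFaithfulTracialState.norm_le_l2Norm (hτ : IsFaithfulTracialState τ) (x : N) :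
    ‖τ x‖ ≤ l2Norm τ x :=
  Real.le_sqrt_of_sq_le (hτ.norm_sq_le x)

theorem IsFaithfulTracialState.norm_le (hτ : IsFaithfulTracialState τ) (x : N) :
    ‖τ x‖ ≤ ‖x‖ := by
  refine (hτ.norm_le_l2Norm x).trans ?_
  have h := hτ.l2Norm_mul_left x 1
  have h1 : l2Norm τ (1 : N) = 1 := by simp [l2Norm, hτ.map_one]
  rwa [mul_one, h1, mul_one] at h

theorem IsFaithfulTracialState.l2Norm_add_le (hτ : IsFaithfulTracialState τ) (x y : N) :
    l2Norm τ (x + y) ≤ 2 * (l2Norm τ x + l2Norm τ y) := by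
  have hx := hτ.nonneg_re x
  have hy := hτ.nonneg_re y
  have h := hτ.nonneg_re (x - y)
  have h' : (τ (star (x + y) * (x + y))).re + (τ (star (x - y) * (x - y))).re
      = 2 * (τ (star x * x)).re + 2 * (τ (star y * y)).re := by
    simp only [star_add, star_sub, add_mul, mul_add, sub_mul, mul_sub, map_add, map_sub,
      Complex.add_re, Complex.sub_re]
    ring
  have ha := Real.sqrt_nonneg (τ (star x * x)).re
  have hb := Real.sqrt_nonneg (τ (star y * y)).re
  refine Real.sqrt_le_iff.mpr ⟨by unfold l2Norm; positivity, ?_⟩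
  have h1 : l2Norm τ x ^ 2 = (τ (star x * x)).re := Real.sq_sqrt hx
  have h2 : l2Norm τ y ^ 2 = (τ (star y * y)).re := Real.sq_sqrt hy
  have h3 : 0 ≤ l2Norm τ x * l2Norm τ y := mul_nonneg ha hb
  nlinarith

/-- `ℓ^∞(ℕ, N)`: the `*`-algebra of bounded sequences in `N`. -/
def boundedSeq (N : Type*) [CStarAlgebra N] : StarSubalgebra ℂ (ℕ → N) where
  carrier := {x | ∃ C : ℝ, ∀ n, ‖x n‖ ≤ C}
  mul_mem' := by
    rintro x y ⟨C, hC⟩ ⟨D, hD⟩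
    exact ⟨C * D, fun n => (norm_mul_le _ _).trans
      (mul_le_mul (hC n) (hD n) (norm_nonneg _) ((norm_nonneg _).trans (hC n)))⟩
  add_mem' := by
    rintro x y ⟨C, hC⟩ ⟨D, hD⟩
    exact ⟨C + D, fun n => (norm_add_le _ _).trans (add_le_add (hC n) (hD n))⟩
  algebraMap_mem' c := ⟨‖algebraMap ℂ N c‖, fun _ => le_rfl⟩
  star_mem' := by
    rintro x ⟨C, hC⟩
    exact ⟨C, fun n => by simpa using hC n⟩

/-- The bounded sequences `x` with `lim_ω ‖xₙ‖₂ = 0`, as an ideal of `ℓ^∞(ℕ, N)`. -/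
noncomputable def ultraIdeal (hτ : IsFaithfulTracialState τ) (ω : Ultrafilter ℕ) :
    Ideal (boundedSeq N) where
  carrier := {x | Tendsto (fun n => l2Norm τ (x.1 n)) ω (𝓝 0)}
  add_mem' := by
    intro x y hx hy
    have h : Tendsto (fun n => 2 * (l2Norm τ (x.1 n) + l2Norm τ (y.1 n))) ω (𝓝 0) := by
      simpa using (hx.add hy).const_mul 2
    exact squeeze_zero (fun n => Real.sqrt_nonneg _) (fun n => hτ.l2Norm_add_le _ _) h
  zero_mem' := by simp [l2Norm]
  smul_mem' := by
    rintro ⟨c, C, hC⟩ x hx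
    have h : Tendsto (fun n => C * l2Norm τ (x.1 n)) ω (𝓝 0) := by
      simpa using hx.const_mul C
    exact squeeze_zero (fun n => Real.sqrt_nonneg _) (fun n => (hτ.l2Norm_mul_left _ _).trans
      (mul_le_mul_of_nonneg_right (hC n) (Real.sqrt_nonneg _))) h

instance ultraIdeal_isTwoSided (hτ : IsFaithfulTracialState τ) (ω : Ultrafilter ℕ) :
    (ultraIdeal hτ ω).IsTwoSided where
  mul_mem_of_left := by
    rintro x ⟨c, C, hC⟩ hx
    have h : Tendsto (fun n => C * l2Norm τ (x.1 n)) ω (𝓝 0) := by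
      simpa using (show Tendsto (fun n => l2Norm τ (x.1 n)) ω (𝓝 0) from hx).const_mul C
    exact squeeze_zero (fun n => Real.sqrt_nonneg _) (fun n => (hτ.l2Norm_mul_right _ _).trans
      (mul_le_mul_of_nonneg_right (hC n) (Real.sqrt_nonneg _))) h

theorem star_mem_ultraIdeal (hτ : IsFaithfulTracialState τ) (ω : Ultrafilter ℕ)
    {x : boundedSeq N} (hx : x ∈ ultraIdeal hτ ω) : star x ∈ ultraIdeal hτ ω :=
  Tendsto.congr (fun n => (hτ.star_swap (x.1 n)).symm)
    (show Tendsto (fun n => l2Norm τ (x.1 n)) ω (𝓝 0) from hx)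

/-- The tracial ultrapower `N^ω`: bounded sequences modulo those with `lim_ω ‖xₙ‖₂ = 0`. -/
abbrev Ultrapower (hτ : IsFaithfulTracialState τ) (ω : Ultrafilter ℕ) : Type _ :=
  boundedSeq N ⧸ ultraIdeal hτ ω

/-- The involution of `N^ω` is the termwise one. -/
noncomputable instance ultrapowerStarRing (hτ : IsFaithfulTracialState τ) (ω : Ultrafilter ℕ) :
    StarRing (Ultrapower hτ ω) where
  star := Quotient.lift (fun x => Ideal.Quotient.mk (ultraIdeal hτ ω) (star x)) (by
    intro x y h
    have h' : x - y ∈ ultraIdeal hτ ω := (Submodule.quotientRel_def _).mp h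
    exact Ideal.Quotient.eq.mpr (star_sub x y ▸ star_mem_ultraIdeal hτ ω h'))
  star_involutive := by
    intro a
    obtain ⟨x, rfl⟩ := Ideal.Quotient.mk_surjective a
    exact congrArg (Ideal.Quotient.mk (ultraIdeal hτ ω)) (star_star x)
  star_mul := by
    intro a b
    obtain ⟨x, rfl⟩ := Ideal.Quotient.mk_surjective a
    obtain ⟨y, rfl⟩ := Ideal.Quotient.mk_surjective b
    exact congrArg (Ideal.Quotient.mk (ultraIdeal hτ ω)) (star_mul x y)
  star_add := by
    intro a b
    obtain ⟨x, rfl⟩ := Ideal.Quotient.mk_surjective a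
    obtain ⟨y, rfl⟩ := Ideal.Quotient.mk_surjective b
    exact congrArg (Ideal.Quotient.mk (ultraIdeal hτ ω)) (star_add x y)

instance ultrapowerStarModule (hτ : IsFaithfulTracialState τ) (ω : Ultrafilter ℕ) :
    StarModule ℂ (Ultrapower hτ ω) where
  star_smul := by
    intro c a
    obtain ⟨x, rfl⟩ := Ideal.Quotient.mk_surjective a
    exact congrArg (Ideal.Quotient.mk (ultraIdeal hτ ω)) (star_smul c x)

/-- The quotient map `ℓ^∞(ℕ, N) → N^ω`. -/
noncomputable def ultraMk (hτ : IsFaithfulTracialState τ) (ω : Ultrafilter ℕ) :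
    boundedSeq N →⋆ₐ[ℂ] Ultrapower hτ ω where
  toAlgHom := Ideal.Quotient.mkₐ ℂ (ultraIdeal hτ ω)
  map_star' _ := rfl

/-- `B^ω ⊂ N^ω`: the classes of bounded sequences in `B`. -/
noncomputable def ultraSubalgebra (hτ : IsFaithfulTracialState τ) (ω : Ultrafilter ℕ)
    (B : StarSubalgebra ℂ N) : StarSubalgebra ℂ (Ultrapower hτ ω) :=
  StarSubalgebra.map (ultraMk hτ ω)
    { carrier := {x : boundedSeq N | ∀ n, x.1 n ∈ B}
      mul_mem' := fun hx hy n => mul_mem (hx n) (hy n)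
      add_mem' := fun hx hy n => add_mem (hx n) (hy n)
      algebraMap_mem' := fun c _ => B.algebraMap_mem c
      star_mem' := fun hx n => star_mem (hx n) }

theorem exists_tendsto (hτ : IsFaithfulTracialState τ) (ω : Ultrafilter ℕ) (x : boundedSeq N) :
    ∃ z : ℂ, Tendsto (fun n => τ (x.1 n)) ω (𝓝 z) := by
  obtain ⟨x, C, hC⟩ := x
  obtain ⟨z, -, hz⟩ := (isCompact_closedBall (0 : ℂ) C).ultrafilter_le_nhds
    (ω.map fun n => τ (x n)) (by
      rw [le_principal_iff]
      refine Filter.mem_map.mpr (Filter.univ_mem' fun n => ?_)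
      simpa using (hτ.norm_le _).trans (hC n))
  exact ⟨z, hz⟩

/-- The trace `τ_ω` of `N^ω`: it maps the class of `(xₙ)` to `lim_ω τ(xₙ)`. -/
noncomputable def ultraTrace (hτ : IsFaithfulTracialState τ) (ω : Ultrafilter ℕ) :
    Ultrapower hτ ω →ₗ[ℂ] ℂ where
  toFun := Quotient.lift (fun x : boundedSeq N => limUnder (ω : Filter ℕ) fun n => τ (x.1 n)) (by
    intro x y h
    have h' : x - y ∈ ultraIdeal hτ ω := (Submodule.quotientRel_def _).mp h
    obtain ⟨z, hz⟩ := exists_tendsto hτ ω y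
    have h1 : Tendsto (fun n => τ ((x - y).1 n)) ω (𝓝 0) :=
      squeeze_zero_norm (fun n => hτ.norm_le_l2Norm _) h'
    have h2 : Tendsto (fun n => τ (x.1 n)) ω (𝓝 z) := by
      have h3 := h1.add hz
      rw [zero_add] at h3
      exact h3.congr fun n => by
        rw [← map_add]
        exact congrArg τ (sub_add_cancel (x.1 n) (y.1 n))
    exact h2.limUnder_eq.trans hz.limUnder_eq.symm)
  map_add' := by
    intro a b
    obtain ⟨x, rfl⟩ := Ideal.Quotient.mk_surjective a
    obtain ⟨y, rfl⟩ := Ideal.Quotient.mk_surjective b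
    obtain ⟨z, hz⟩ := exists_tendsto hτ ω x
    obtain ⟨w, hw⟩ := exists_tendsto hτ ω y
    have h : Tendsto (fun n => τ ((x + y).1 n)) ω (𝓝 (z + w)) :=
      (hz.add hw).congr fun n => (map_add τ _ _).symm
    exact h.limUnder_eq.trans (congrArg₂ (· + ·) hz.limUnder_eq hw.limUnder_eq).symm
  map_smul' := by
    intro c a
    obtain ⟨x, rfl⟩ := Ideal.Quotient.mk_surjective a
    obtain ⟨z, hz⟩ := exists_tendsto hτ ω x
    have h : Tendsto (fun n => τ ((c • x).1 n)) ω (𝓝 (c * z)) :=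
      (hz.const_mul c).congr fun n => (map_smul τ c _).symm
    exact h.limUnder_eq.trans (congrArg (c * ·) hz.limUnder_eq).symm

end Ultrapower

end Paving

open Paving

/-! The lower bounds rest on self-adjoint unitaries x orthogonal to A that are almost 2-independent
of A: τ(axax) ≥ τ(a)² - δ τ(a²) for self-adjoint a in A. If n orthogonal projections p_k of A add up
to 1, then ‖∑ p_k x p_k‖₂² = ∑ τ(p_k x p_k x) ≥ ∑ τ(p_k)² - δ ≥ 1/n - δ by Cauchy–Schwarz, and this
exceeds ε² for small δ (`IsFaithfulTracialState.lt_l2Norm_sum`).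

Such x come from `HasNoMinimalProjections.exists_almost_independent`. Cut 1 into 2^k projections e_i
of A with equal traces, take partial isometries v_i from one of them onto each e_i, and put x = ∑
c_ij v_i v_j*, where c is a hermitian unitary matrix with zero diagonal and |c_ij|² = 1/(2^k - 1)
elsewhere. The zero diagonal makes x orthogonal to A. Flatness makes τ(axax) equal to (τ(W²) -
τ(a²))/(2^k - 1), where W = ∑ v_i* a v_i has trace τ(a) and lives under a projection of trace 2^-k,
so that τ(W²) ≥ 2^k τ(a)². In the ultrapower the constant sequence x serves.

For the upper bound, let x in M be orthogonal to the MASA A. A weak limit of 2-norm minimising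
pinchings of x by partitions in A commutes with A, hence lies in A, and it is orthogonal to A, hence
is zero; so some pinching is arbitrarily small (`HasWeakLimits.exists_partition_l2Norm_lt`). Its
pieces are then grouped into n classes so that at most one n-th of ‖x‖₂² is added
(`IsPartition.exists_merge`). Along the ultrapower the error disappears, leaving ‖x‖₂²/n ≤ ε²‖x‖₂².

The conditional expectations are nearest points for the 2-norm. A MASA is diffuse because a minimal
projection of A would be minimal in M and force M to be finite dimensional. -/

namespace Paving

/-! ### The two properties of von Neumann algebras on which the abstract arguments rely. -/

section WeakLimits

variable {N : Type*} [CStarAlgebra N]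

/-- Norm bounded families in `B` have weak limits in `B`, along every ultrafilter, where weak
convergence is tested by the functionals `τ(· b)`. -/
def HasWeakLimits (τ : N →ₗ[ℂ] ℂ) (B : StarSubalgebra ℂ N) : Prop :=
  ∀ (U : Ultrafilter N) (C : ℝ), (∀ᶠ z in (U : Filter N), z ∈ B ∧ ‖z‖ ≤ C) →
    ∃ y ∈ B, ‖y‖ ≤ C ∧ ∀ b, Tendsto (fun z => τ (z * b)) U (𝓝 (τ (y * b)))

/-- Every element of `B` has a range projection in `B`. -/
def HasRangeProjections (B : StarSubalgebra ℂ N) : Prop :=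
  ∀ h ∈ B, ∃ q ∈ B, IsStarProjection q ∧ q * h = h ∧ ∀ z, z * h = 0 → z * q = 0

end WeakLimits

/-! ### Operators on Hilbert space: weak limits, range projections, factors and MASAs. -/

section Hilbert

variable {H : Type*} [NormedAddCommGroup H] [InnerProductSpace ℂ H] [CompleteSpace H]

/-- The matrix coefficients stay in compact discs, so they converge along the ultrafilter to a
bounded sesquilinear form, which is represented by an operator. -/
theorem exists_weak_operator_limit {ι : Type*} (U : Ultrafilter ι) (T : ι → H →L[ℂ] H) {C : ℝ}
    (hT : ∀ᶠ i in (U : Filter ι), ‖T i‖ ≤ C) :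
    ∃ S : H →L[ℂ] H, ‖S‖ ≤ C ∧
      ∀ v w, Tendsto (fun i => inner ℂ v (T i w)) U (𝓝 (inner ℂ v (S w))) := by
  have hC : 0 ≤ C := by
    obtain ⟨i, hi⟩ := hT.exists
    exact (norm_nonneg _).trans hi
  have hlim : ∀ v w, ∃ z : ℂ, Tendsto (fun i => inner ℂ (T i v) w) U (𝓝 z) ∧
      ‖z‖ ≤ C * ‖v‖ * ‖w‖ := by
    intro v w
    obtain ⟨z, hz, hz'⟩ := (isCompact_closedBall (0 : ℂ) (C * ‖v‖ * ‖w‖)).ultrafilter_le_nhds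
      (U.map fun i => inner ℂ (T i v) w) (by
        rw [le_principal_iff]
        refine hT.mono fun i hi => ?_
        simp only [Metric.mem_closedBall, dist_zero_right]
        exact (norm_inner_le_norm _ _).trans (mul_le_mul_of_nonneg_right
          ((T i).le_of_opNorm_le hi v) (norm_nonneg _)))
    exact ⟨z, hz', by simpa using hz⟩
  choose L hL hLn using hlim
  let F : H →ₗ⋆[ℂ] H →ₗ[ℂ] ℂ := LinearMap.mk₂'ₛₗ (starRingEnd ℂ) (RingHom.id ℂ) L
    (fun v v' w => tendsto_nhds_unique (hL (v + v') w) (by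
      simpa [inner_add_left] using (hL v w).add (hL v' w)))
    (fun c v w => tendsto_nhds_unique (hL (c • v) w) (by
      simpa [inner_smul_left, mul_comm] using (hL v w).const_mul (starRingEnd ℂ c)))
    (fun v w w' => tendsto_nhds_unique (hL v (w + w')) (by
      simpa [inner_add_right] using (hL v w).add (hL v w')))
    (fun c v w => tendsto_nhds_unique (hL v (c • w)) (by
      simpa [inner_smul_right] using (hL v w).const_mul c))
  let G : H →L⋆[ℂ] H →L[ℂ] ℂ := F.mkContinuous₂ C hLn
  have hG : ∀ v w, inner ℂ (InnerProductSpace.continuousLinearMapOfBilin G v) w = L v w :=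
    fun v w => InnerProductSpace.continuousLinearMapOfBilin_apply G v w
  refine ⟨InnerProductSpace.continuousLinearMapOfBilin G, ?_, fun v w => ?_⟩
  · refine ContinuousLinearMap.opNorm_le_bound _ hC fun v => ?_
    set u := InnerProductSpace.continuousLinearMapOfBilin G v with hu
    have h1 : ‖u‖ * ‖u‖ ≤ C * ‖v‖ * ‖u‖ := by
      have := hLn v u
      rw [← hG v u, ← hu, inner_self_eq_norm_sq_to_K] at this
      simpa [pow_two] using this
    rcases (norm_nonneg u).eq_or_lt with h0 | h0
    · rw [← h0]; positivity
    · exact le_of_mul_le_mul_right h1 h0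
  · have := (hL w v)
    rw [← hG] at this
    have h2 := (Complex.continuous_conj.tendsto _).comp this
    simp only [Function.comp_def, inner_conj_symm] at h2
    exact h2

/-- By the bicommutant theorem membership in A means commuting with the commutant of A, and
commuting with a fixed operator survives weak operator limits. -/
theorem mem_of_weak_operator_limit {ι : Type*} {U : Ultrafilter ι} {T : ι → H →L[ℂ] H}
    {S : H →L[ℂ] H} (A : VonNeumannAlgebra H) (hA : ∀ᶠ i in (U : Filter ι), T i ∈ A)
    (hS : ∀ v w, Tendsto (fun i => inner ℂ v (T i w)) U (𝓝 (inner ℂ v (S w)))) : S ∈ A := by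
  rw [← VonNeumannAlgebra.commutant_commutant A, VonNeumannAlgebra.mem_commutant_iff]
  intro g hg
  ext w
  refine ext_inner_left ℂ fun v => ?_
  have h1 := hS v (g w)
  have h2 := hS (star g v) w
  rw [ContinuousLinearMap.star_eq_adjoint] at h2
  simp only [ContinuousLinearMap.adjoint_inner_left] at h2
  refine tendsto_nhds_unique h2 (h1.congr' ?_)
  filter_upwards [hA] with i hi
  have := VonNeumannAlgebra.mem_commutant_iff.mp hg _ hi
  exact congrArg (fun f : H →L[ℂ] H => inner ℂ v (f w)) this

/-- Dominated convergence in the series defining τ, with dominating terms C‖ξ k‖‖η k‖. -/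
theorem IsNormalFunctional.tendsto {M : VonNeumannAlgebra H} {τ : M.toStarSubalgebra →ₗ[ℂ] ℂ}
    (hn : IsNormalFunctional M τ) {ι : Type*} {U : Ultrafilter ι} {T : ι → M.toStarSubalgebra}
    {S : M.toStarSubalgebra} {C : ℝ} (hT : ∀ᶠ i in (U : Filter ι), ‖T i‖ ≤ C)
    (hS : ∀ v w, Tendsto (fun i => inner ℂ v ((T i : H →L[ℂ] H) w)) U
      (𝓝 (inner ℂ v ((S : H →L[ℂ] H) w)))) :
    Tendsto (fun i => τ (T i)) U (𝓝 (τ S)) := by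
  obtain ⟨ξ, η, hξ, hη, h⟩ := hn
  have hs : Summable fun k => C * (‖ξ k‖ * ‖η k‖) := by
    refine Summable.mul_left _ ?_
    refine Summable.of_nonneg_of_le (fun k => by positivity) (fun k => ?_) (hξ.add hη)
    nlinarith [sq_nonneg (‖ξ k‖ - ‖η k‖), sq_nonneg (‖ξ k‖), sq_nonneg (‖η k‖)]
  have := tendsto_tsum_of_dominated_convergence (𝓕 := (U : Filter ι))
    (f := fun i k => inner ℂ (ξ k) ((T i : H →L[ℂ] H) (η k)))
    (g := fun k => inner ℂ (ξ k) ((S : H →L[ℂ] H) (η k))) hs (fun k => hS _ _) (by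
      filter_upwards [hT] with i hi k
      refine (norm_inner_le_norm _ _).trans ?_
      have := (T i : H →L[ℂ] H).le_of_opNorm_le hi (η k)
      calc ‖ξ k‖ * ‖(T i : H →L[ℂ] H) (η k)‖ ≤ ‖ξ k‖ * (C * ‖η k‖) :=
            mul_le_mul_of_nonneg_left this (norm_nonneg _)
        _ = _ := by ring)
  rw [(h S).tsum_eq] at this
  exact this.congr fun i => (h (T i)).tsum_eq

/-- Balls of A are compact for the weak operator topology, and on bounded sets τ(· b) is continuous
for it. -/
theorem IsNormalFunctional.hasWeakLimits {M A : VonNeumannAlgebra H}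
    {τ : M.toStarSubalgebra →ₗ[ℂ] ℂ} (hn : IsNormalFunctional M τ) :
    HasWeakLimits τ (subalgebraOf M A) := by
  intro U C hU
  obtain ⟨S, hSC, hS⟩ := exists_weak_operator_limit U
    (fun z : M.toStarSubalgebra => (z : H →L[ℂ] H)) (hU.mono fun z hz => hz.2)
  have hSM : S ∈ M := mem_of_weak_operator_limit M (Eventually.of_forall fun z => z.2) hS
  have hSA : S ∈ A := mem_of_weak_operator_limit A (hU.mono fun z hz => hz.1) hS
  refine ⟨⟨S, hSM⟩, hSA, hSC, fun b => ?_⟩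
  refine hn.tendsto (C := C * ‖b‖) (hU.mono fun z hz => (norm_mul_le _ _).trans
    (mul_le_mul_of_nonneg_right hz.2 (norm_nonneg _))) fun v w => ?_
  exact hS v ((b : H →L[ℂ] H) w)

/-- The projection onto the closure of a subspace invariant under the commutant is in the
algebra. -/
theorem starProjection_mem (A : VonNeumannAlgebra H) (K : Submodule ℂ H)
    [K.HasOrthogonalProjection] (hK : ∀ y ∈ A.commutant, ∀ v ∈ K, y v ∈ K) :
    K.starProjection ∈ A := by
  rw [VonNeumannAlgebra.IsStarProjection.mem_iff isStarProjection_starProjection]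
  intro y hy v hv
  rw [Submodule.range_starProjection] at hv ⊢
  exact hK y hy v hv

/-- The closed range of h is invariant under the commutant of A, so its projection belongs to A. An
operator that kills h vanishes on that closed range. -/
theorem exists_range_projection (A : VonNeumannAlgebra H) {h : H →L[ℂ] H} (hh : h ∈ A) :
    ∃ q ∈ A, IsStarProjection q ∧ q * h = h ∧ ∀ z : H →L[ℂ] H, z * h = 0 → z * q = 0 := by
  let K : Submodule ℂ H := (LinearMap.range (h : H →ₗ[ℂ] H)).topologicalClosure
  have hKc : IsClosed (K : Set H) := Submodule.isClosed_topologicalClosure _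
  have : CompleteSpace K := hKc.completeSpace_coe
  refine ⟨K.starProjection, starProjection_mem A K ?_, isStarProjection_starProjection, ?_, ?_⟩
  · intro y hy
    have hc := VonNeumannAlgebra.mem_commutant_iff.mp hy _ hh
    refine fun v hv => (Submodule.topologicalClosure_mem_invtSubmodule (f := y) ?_) hv
    rintro _ ⟨w, rfl⟩
    exact ⟨y w, congrArg (fun f : H →L[ℂ] H => f w) hc⟩
  · ext v
    exact Submodule.starProjection_eq_self_iff.mpr
      (Submodule.le_topologicalClosure _ (LinearMap.mem_range_self _ v))
  · intro z hz
    have hle : K ≤ LinearMap.ker (z : H →ₗ[ℂ] H) := by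
      refine Submodule.topologicalClosure_minimal _ ?_ z.isClosed_ker
      rintro _ ⟨v, rfl⟩
      exact congrArg (fun f : H →L[ℂ] H => f v) hz
    ext v
    exact hle (Submodule.starProjection_apply_mem K v)

theorem hasRangeProjections_subalgebraOf {M A : VonNeumannAlgebra H} (hAM : A ≤ M) :
    HasRangeProjections (subalgebraOf M A) := by
  intro h hh
  obtain ⟨q, hqA, hq, hqh, hz⟩ := exists_range_projection A (h := (h : H →L[ℂ] H)) hh
  exact ⟨⟨q, hAM hqA⟩, hqA, ⟨Subtype.ext hq.1, Subtype.ext hq.2⟩, Subtype.ext hqh,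
    fun z hzh => Subtype.ext (hz z (congrArg Subtype.val hzh))⟩

theorem isClosed_subalgebraOf (M A : VonNeumannAlgebra H) :
    IsClosed (subalgebraOf M A : Set M.toStarSubalgebra) :=
  (isClosed_toStarSubalgebra A).preimage continuous_subtype_val

theorem subalgebraOf_self (M : VonNeumannAlgebra H) : subalgebraOf M M = ⊤ :=
  eq_top_iff.mpr fun x _ => x.2

/-- In a factor, two non-zero elements are not orthogonal up to inner multiplication. -/
theorem IsIIOneFactor.eq_zero_or_eq_zero {M : VonNeumannAlgebra H} (hM : IsIIOneFactor M)
    {z e : M.toStarSubalgebra} (h : ∀ y, z * y * e = 0) : z = 0 ∨ e = 0 := by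
  -- The closed span K of the ranges of all y * e is invariant under M and under its commutant, so
  -- its projection is central, hence a scalar c. If c = 0 then e = 0; otherwise K is everything,
  -- and z vanishes on K.
  let L : Submodule ℂ H :=
    ⨆ y : M.toStarSubalgebra, LinearMap.range ((y * e : M.toStarSubalgebra) : H →L[ℂ] H).toLinearMap
  have hL : ∀ (y : M.toStarSubalgebra) (v : H), ((y * e : M.toStarSubalgebra) : H →L[ℂ] H) v ∈ L :=
    fun y v => Submodule.mem_iSup_of_mem y ⟨v, rfl⟩
  let K : Submodule ℂ H := L.topologicalClosure
  have hKc : IsClosed (K : Set H) := Submodule.isClosed_topologicalClosure _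
  have : CompleteSpace K := hKc.completeSpace_coe
  have hinv : ∀ g : H →L[ℂ] H, (∀ (y : M.toStarSubalgebra) (v : H),
      g (((y * e : M.toStarSubalgebra) : H →L[ℂ] H) v) ∈ L) → ∀ v ∈ K, g v ∈ K := by
    intro g hg v hv
    refine (Submodule.topologicalClosure_mem_invtSubmodule (f := g) ?_) hv
    refine iSup_le (α := Submodule ℂ H) fun y => ?_
    rintro _ ⟨v, rfl⟩
    exact hg y v
  have hqM : K.starProjection ∈ M := by
    refine starProjection_mem M K fun g hg => hinv g fun y v => ?_
    have h1 := VonNeumannAlgebra.mem_commutant_iff.mp hg _ (y * e).2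
    rw [← mul_apply_eq_comp, ← h1]
    exact hL y (g v)
  have hqM' : K.starProjection ∈ M.commutant := by
    refine starProjection_mem M.commutant K fun g hg => hinv g fun y v => ?_
    rw [VonNeumannAlgebra.commutant_commutant] at hg
    rw [← mul_apply_eq_comp]
    have := hL (⟨g, hg⟩ * y) v
    rwa [mul_assoc] at this
  obtain ⟨c, hc⟩ := hM.factor _ hqM
    fun y hy => (VonNeumannAlgebra.mem_commutant_iff.mp hqM' y hy).symm
  have hz : ∀ v ∈ K, (z : H →L[ℂ] H) v = 0 := by
    have hle : K ≤ LinearMap.ker ((z : H →L[ℂ] H) : H →ₗ[ℂ] H) := by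
      refine Submodule.topologicalClosure_minimal _ (iSup_le (α := Submodule ℂ H) fun y => ?_)
        (z : H →L[ℂ] H).isClosed_ker
      rintro _ ⟨v, rfl⟩
      have := congrArg (fun f : M.toStarSubalgebra => (f : H →L[ℂ] H) v) (h y)
      rwa [mul_assoc] at this
    exact fun v hv => hle hv
  by_cases hc0 : c = 0
  · right
    ext v
    have h1 := hL 1 v
    rw [one_mul] at h1
    have h2 := Submodule.starProjection_eq_self_iff.mpr (Submodule.le_topologicalClosure _ h1)
    change K.starProjection _ = _ at h2
    rw [hc, hc0, zero_smul] at h2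
    exact h2.symm
  · left
    ext v
    have h1 := hz _ (Submodule.starProjection_apply_mem K v)
    rw [hc] at h1
    simpa [hc0] using h1

/-- Adjoining z to A yields an abelian `*`-subalgebra of M, which maximality absorbs.
Self-adjointness keeps the generating set closed under the involution. -/
theorem IsMASA.mem_of_commute_of_isSelfAdjoint {M A : VonNeumannAlgebra H} (hA : IsMASA M A)
    {z : H →L[ℂ] H} (hzM : z ∈ M) (hsa : IsSelfAdjoint z) (hz : ∀ b ∈ A, z * b = b * z) :
    z ∈ A := by
  have hstar : ∀ x ∈ insert z (A : Set (H →L[ℂ] H)), star x ∈ insert z (A : Set (H →L[ℂ] H)) := by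
    rintro x (rfl | hx)
    · exact Or.inl hsa.star_eq
    · exact Or.inr (star_mem hx)
  have hcomm : ∀ x ∈ insert z (A : Set (H →L[ℂ] H)), ∀ y ∈ insert z (A : Set (H →L[ℂ] H)),
      x * y = y * x := by
    rintro x (rfl | hx) y (rfl | hy)
    · rfl
    · exact hz y hy
    · exact (hz x hx).symm
    · exact hA.abelian x hx y hy
  have hc := StarAlgebra.isMulCommutative_adjoin ℂ hcomm fun x hx y hy =>
    hcomm x hx (star y) (hstar y hy)
  refine hA.maximal (StarAlgebra.adjoin ℂ (insert z (A : Set (H →L[ℂ] H)))) ?_ ?_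
    (fun x hx => StarAlgebra.subset_adjoin ℂ _ (Or.inr hx)) z
    (StarAlgebra.subset_adjoin ℂ _ (Or.inl rfl))
  · have hle : StarAlgebra.adjoin ℂ (insert z (A : Set (H →L[ℂ] H))) ≤ M.toStarSubalgebra := by
      refine StarAlgebra.adjoin_le ?_
      rintro x (rfl | hx)
      · exact hzM
      · exact hA.le hx
    exact fun x hx => hle hx
  · intro x hx y hy
    exact congrArg Subtype.val (hc.is_comm.comm ⟨x, hx⟩ ⟨y, hy⟩)

theorem IsMASA.mem_of_commute {M A : VonNeumannAlgebra H} (hA : IsMASA M A)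
    {z : M.toStarSubalgebra} (hz : ∀ b ∈ subalgebraOf M A, z * b = b * z) :
    z ∈ subalgebraOf M A := by
  have hz1 : ∀ b ∈ A, (z : H →L[ℂ] H) * b = b * z := fun b hb =>
    congrArg Subtype.val (hz ⟨b, hA.le hb⟩ hb)
  have hz2 : ∀ b ∈ A, star (z : H →L[ℂ] H) * b = b * star (z : H →L[ℂ] H) := fun b hb => by
    have := congrArg star (hz1 _ (star_mem hb))
    rw [star_mul, star_mul, star_star] at this
    exact this.symm
  have hre := hA.mem_of_commute_of_isSelfAdjoint
    (z := (z : H →L[ℂ] H) + star (z : H →L[ℂ] H)) (add_mem z.2 (star_mem z.2))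
    (IsSelfAdjoint.add_star_self _) fun b hb => by rw [add_mul, mul_add, hz1 b hb, hz2 b hb]
  have him := hA.mem_of_commute_of_isSelfAdjoint
    (z := Complex.I • ((z : H →L[ℂ] H) - star (z : H →L[ℂ] H)))
    (M.smul_mem (sub_mem z.2 (star_mem z.2)) _)
    (by simp [IsSelfAdjoint, star_smul, smul_sub, neg_add_eq_sub])
    fun b hb => by
      rw [smul_mul_assoc, mul_smul_comm, sub_mul, mul_sub, hz1 b hb, hz2 b hb]
  have h : (z : H →L[ℂ] H) = (2⁻¹ : ℂ) • ((z : H →L[ℂ] H) + star (z : H →L[ℂ] H))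
      + (-(2⁻¹ * Complex.I) : ℂ) • (Complex.I • ((z : H →L[ℂ] H) - star (z : H →L[ℂ] H))) := by
    rw [smul_smul, neg_mul, mul_assoc, Complex.I_mul_I]
    module
  change (z : H →L[ℂ] H) ∈ A.toStarSubalgebra
  rw [h]
  exact add_mem (A.smul_mem hre _) (A.smul_mem him _)

end Hilbert

/-! ### Traces, partitions and expectations without a norm, so as to cover the ultrapower as well.
-/

section TracialAlgebra

set_option linter.unusedSectionVars false

variable {N : Type*} [Ring N] [StarRing N] [Algebra ℂ N] [StarModule ℂ N] {τ : N →ₗ[ℂ] ℂ}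
  {B : StarSubalgebra ℂ N}

theorem IsFaithfulTracialState.map_star (hτ : IsFaithfulTracialState τ) (x : N) :
    τ (star x) = star (τ x) := by
  have h0 := hτ.nonneg_im 1
  have h1 := hτ.nonneg_im x
  have h2 := hτ.nonneg_im (1 + x)
  have h3 := hτ.nonneg_im (1 + Complex.I • x)
  simp only [star_add, star_one, add_mul, mul_add, one_mul, mul_one, map_add, star_smul,
    smul_mul_assoc, mul_smul_comm, map_smul, smul_eq_mul, Complex.add_im, Complex.mul_im,
    Complex.I_re, Complex.I_im, Complex.star_def, Complex.conj_I, Complex.neg_re, Complex.neg_im,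
    Complex.mul_re] at h0 h1 h2 h3
  apply Complex.ext
  · simp only [Complex.star_def, Complex.conj_re]
    linarith
  · simp only [Complex.star_def, Complex.conj_im]
    linarith

theorem IsFaithfulTracialState.l2Norm_sq (hτ : IsFaithfulTracialState τ) (x : N) :
    l2Norm τ x ^ 2 = (τ (star x * x)).re :=
  Real.sq_sqrt (hτ.nonneg_re x)

theorem IsFaithfulTracialState.ofReal_l2Norm_sq (hτ : IsFaithfulTracialState τ) (x : N) :
    ((l2Norm τ x ^ 2 : ℝ) : ℂ) = τ (star x * x) := by
  apply Complex.ext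
  · rw [hτ.l2Norm_sq, Complex.ofReal_re]
  · rw [Complex.ofReal_im, hτ.nonneg_im]

theorem l2Norm_nonneg (τ : N →ₗ[ℂ] ℂ) (x : N) : 0 ≤ l2Norm τ x :=
  Real.sqrt_nonneg _

theorem IsFaithfulTracialState.eq_zero_of_l2Norm (hτ : IsFaithfulTracialState τ) {x : N}
    (h : l2Norm τ x = 0) : x = 0 :=
  hτ.faithful x (by rw [← hτ.ofReal_l2Norm_sq, h]; simp)

theorem IsFaithfulTracialState.eq_of_forall (hτ : IsFaithfulTracialState τ) {x y : N}
    (h : ∀ b, τ (x * b) = τ (y * b)) : x = y := by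
  refine sub_eq_zero.mp (hτ.faithful _ ?_)
  rw [hτ.tracial, sub_mul, map_sub, h, sub_self]

theorem IsFaithfulTracialState.im_eq_zero (hτ : IsFaithfulTracialState τ) {x : N}
    (hx : IsSelfAdjoint x) : (τ x).im = 0 := by
  have := hτ.map_star x
  rw [hx.star_eq] at this
  exact Complex.conj_eq_iff_im.mp this.symm

theorem IsFaithfulTracialState.norm_map_mul_le (hτ : IsFaithfulTracialState τ) (x y : N) :
    ‖τ (star x * y)‖ ≤ l2Norm τ x * l2Norm τ y := by
  let c : PreInnerProductSpace.Core ℂ N :=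
    { inner := fun x y => τ (star x * y)
      conj_inner_symm := fun x y => by
        change star (τ (star y * x)) = _
        rw [← hτ.map_star, star_mul, star_star]
      re_inner_nonneg := fun x => hτ.nonneg_re x
      add_left := fun x y z => by simp [add_mul]
      smul_left := fun x y r => by simp [star_smul] }
  exact @InnerProductSpace.Core.norm_inner_le_norm ℂ N _ _ _ c x y

theorem IsFaithfulTracialState.norm_map_mul_le' (hτ : IsFaithfulTracialState τ) (x y : N) :
    ‖τ (x * y)‖ ≤ l2Norm τ x * l2Norm τ y := by
  have := hτ.norm_map_mul_le (star x) y
  rw [star_star] at this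
  rwa [show l2Norm τ (star x) = l2Norm τ x by rw [l2Norm, l2Norm, star_star, hτ.tracial]] at this

/-- Projections that add up to `1` are pairwise orthogonal in the presence of a faithful trace. -/
theorem IsFaithfulTracialState.mul_eq_zero_of_sum_eq_one (hτ : IsFaithfulTracialState τ)
    {ι : Type*} [Fintype ι] {p : ι → N} (hp : ∀ i, IsStarProjection (p i))
    (h1 : ∑ i, p i = 1) {i j : ι} (hij : i ≠ j) : p i * p j = 0 := by
  classical
  have hs : ∀ k, star (p k) = p k := fun k => (hp k).2
  have hi : ∀ k, p k * p k = p k := fun k => (hp k).1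
  have key : ∀ k, star (p k * p j) * (p k * p j) = p j * p k * p j := fun k => by
    rw [star_mul, hs, hs, ← mul_assoc, mul_assoc (p j), hi]
  -- The summand k = j is already p j, so the traces of the other, positive, summands add up to zero
  -- and vanish one by one.
  have h2 : ∑ k, p j * p k * p j = p j := by
    rw [← Finset.sum_mul, ← Finset.mul_sum, h1, mul_one, hi]
  rw [← Finset.add_sum_erase _ _ (Finset.mem_univ j), hi, hi, add_eq_left] at h2
  have h3 := congrArg (fun x => (τ x).re) h2
  simp only [map_sum, Complex.re_sum, map_zero, Complex.zero_re] at h3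
  rw [Finset.sum_eq_zero_iff_of_nonneg (fun k _ => by rw [← key]; exact hτ.nonneg_re _)] at h3
  have h4 := h3 i (Finset.mem_erase.mpr ⟨hij, Finset.mem_univ _⟩)
  refine hτ.faithful _ (Complex.ext ?_ (hτ.nonneg_im _))
  rw [key, h4, Complex.zero_re]

/-- Orthogonality removes the cross terms. Each summand on the right is a bilinear form evaluated at
(p i, p i), which suits both the independence estimate and the merging of projections. -/
theorem IsFaithfulTracialState.l2Norm_sq_sum (hτ : IsFaithfulTracialState τ)
    {ι : Type*} [Fintype ι] {p : ι → N} (hp : ∀ i, IsStarProjection (p i))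
    (ho : ∀ i j, i ≠ j → p i * p j = 0) (x : N) :
    l2Norm τ (∑ i, p i * x * p i) ^ 2 = ∑ i, (τ (p i * star x * p i * x)).re := by
  classical
  have hs : ∀ k, star (p k) = p k := fun k => (hp k).2
  have hi : ∀ k, p k * p k = p k := fun k => (hp k).1
  rw [hτ.l2Norm_sq, star_sum, Finset.sum_mul_sum, map_sum, Complex.re_sum]
  refine Finset.sum_congr rfl fun i _ => ?_
  rw [Finset.sum_eq_single i]
  · rw [star_mul, star_mul, hs]
    have : p i * (star x * p i) * (p i * x * p i) = p i * star x * p i * x * p i := by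
      rw [show p i * (star x * p i) * (p i * x * p i)
        = p i * star x * (p i * p i) * x * p i by simp only [mul_assoc], hi]
    rw [this, hτ.tracial]
    rw [show p i * (p i * star x * p i * x) = (p i * p i) * star x * p i * x by
      simp only [mul_assoc], hi]
  · intro j _ hj
    have : star (p i * x * p i) * (p j * x * p j) = p i * star x * (p i * p j) * x * p j := by
      simp only [star_mul, hs, mul_assoc]
    rw [this, ho i j hj.symm]
    simp
  · simp

/-- A conditional expectation exists as soon as each element has a candidate for its value. -/
theorem IsFaithfulTracialState.isCondExp_condExp (hτ : IsFaithfulTracialState τ)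
    (h : ∀ x, ∃ y ∈ B, ∀ b ∈ B, τ (y * b) = τ (x * b)) : IsCondExp τ B (condExp τ B) := by
  have huniq : ∀ y ∈ B, ∀ z ∈ B, (∀ b ∈ B, τ (y * b) = τ (z * b)) → y = z := by
    intro y hy z hz hyz
    refine sub_eq_zero.mp (hτ.faithful _ ?_)
    rw [hτ.tracial, sub_mul, map_sub, hyz _ (star_mem (sub_mem hy hz)), sub_self]
  choose F hFB hF using h
  have hex : ∃ E, IsCondExp τ B E := by
    refine ⟨⟨⟨F, fun x y => ?_⟩, fun c x => ?_⟩, hFB, fun b hb => ?_, fun b hb c hc x => ?_,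
      fun x => ?_⟩
    · refine huniq _ (hFB _) _ (add_mem (hFB _) (hFB _)) fun b hb => ?_
      rw [hF _ b hb, add_mul, add_mul, map_add, map_add, hF _ b hb, hF _ b hb]
    · refine huniq _ (hFB _) _ (B.smul_mem (hFB _) c) fun b hb => ?_
      simp only [RingHom.id_apply, smul_mul_assoc, map_smul]
      rw [hF _ b hb, hF _ b hb, smul_mul_assoc, map_smul]
    · exact huniq _ (hFB _) _ hb fun c hc => hF _ c hc
    · refine huniq _ (hFB _) _ (mul_mem (mul_mem hb (hFB _)) hc) fun d hd => ?_
      have e1 : ∀ z : N, τ (b * z * c * d) = τ (z * (c * d * b)) := fun z => by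
        rw [mul_assoc, mul_assoc, hτ.tracial, mul_assoc, mul_assoc]
      change τ (F (b * x * c) * d) = τ (b * F x * c * d)
      rw [hF _ d hd, e1, e1, hF _ _ (mul_mem (mul_mem hc hd) hb)]
    · have := hF x 1 (one_mem B)
      rwa [mul_one, mul_one] at this
  rw [condExp, dif_pos hex]
  exact hex.choose_spec

theorem IsCondExp.map_mul {E : N →ₗ[ℂ] N} (hE : IsCondExp τ B E) (x : N) {b : N} (hb : b ∈ B) :
    τ (E x * b) = τ (x * b) := by
  have h1 := hE.bimodular 1 (one_mem B) b hb x
  rw [one_mul, one_mul] at h1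
  rw [← h1, hE.trace_preserving]

theorem IsCondExp.eq_zero_iff (hτ : IsFaithfulTracialState τ) {E : N →ₗ[ℂ] N}
    (hE : IsCondExp τ B E) (x : N) : E x = 0 ↔ ∀ b ∈ B, τ (x * b) = 0 := by
  constructor
  · intro h b hb
    rw [← hE.map_mul x hb, h, zero_mul, map_zero]
  · intro h
    refine hτ.faithful _ ?_
    rw [hτ.tracial, hE.map_mul x (star_mem (hE.mem x)), h _ (star_mem (hE.mem x))]

/-- A self-adjoint unitary that is almost `2`-independent of `B` cannot be paved efficiently. -/
theorem IsFaithfulTracialState.lt_l2Norm_sum (hτ : IsFaithfulTracialState τ) {x : N}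
    (hx : IsSelfAdjoint x) {δ ε : ℝ} {n : ℕ} (hδ : n * (ε ^ 2 + δ) < 1)
    (h : ∀ a ∈ B, IsSelfAdjoint a → (τ a).re ^ 2 - δ * (τ (a * a)).re ≤ (τ (a * x * a * x)).re)
    {p : Fin n → N} (hp : IsPartition B p) : ε < l2Norm τ (∑ k, p k * x * p k) := by
  have ho : ∀ i j, i ≠ j → p i * p j = 0 := fun i j hij =>
    hτ.mul_eq_zero_of_sum_eq_one hp.isStarProjection hp.sum_eq_one hij
  refine lt_of_pow_lt_pow_left₀ 2 (l2Norm_nonneg _ _) ?_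
  rw [hτ.l2Norm_sq_sum hp.isStarProjection ho, hx.star_eq]
  have hsum : ∑ k, (τ (p k)).re = 1 := by
    rw [← Complex.re_sum, ← map_sum, hp.sum_eq_one, hτ.map_one, Complex.one_re]
  -- For a projection the error term is δ τ(p k), so the total loss is just δ. What remains is
  -- Cauchy–Schwarz for the n numbers τ(p k) of sum 1.
  have h1 : ∑ k, ((τ (p k)).re ^ 2 - δ * (τ (p k)).re) ≤ ∑ k, (τ (p k * x * p k * x)).re := by
    refine Finset.sum_le_sum fun k _ => ?_
    have := h (p k) (hp.mem k) (hp.isStarProjection k).2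
    rwa [(hp.isStarProjection k).1.eq] at this
  rw [Finset.sum_sub_distrib, ← Finset.mul_sum, hsum] at h1
  have h2 : (∑ k, (τ (p k)).re) ^ 2 ≤ n * ∑ k, (τ (p k)).re ^ 2 := by
    simpa using sq_sum_le_card_mul_sum_sq (s := Finset.univ) (f := fun k => (τ (p k)).re)
  rw [hsum] at h2
  have hn : (0 : ℝ) < n := by
    rcases Nat.eq_zero_or_pos n with rfl | h0
    · norm_num at h2
    · exact_mod_cast h0
  refine lt_of_lt_of_le ?_ h1
  refine lt_of_mul_lt_mul_left ?_ hn.le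
  nlinarith

end TracialAlgebra

/-! ### Calculus of weak limits tested by the trace; faithfulness makes them unique. -/

section WeakTendsto

set_option linter.unusedSectionVars false

variable {N : Type*} [Ring N] [StarRing N] [Algebra ℂ N] [StarModule ℂ N] {τ : N →ₗ[ℂ] ℂ}
  {ι : Type*} {f g : ι → N} {l : Filter ι} {x y : N}

/-- Weak convergence, tested by the functionals `τ(· b)`. -/
def WeakTendsto (τ : N →ₗ[ℂ] ℂ) (f : ι → N) (l : Filter ι) (y : N) : Prop :=
  ∀ b, Tendsto (fun i => τ (f i * b)) l (𝓝 (τ (y * b)))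

theorem WeakTendsto.unique [l.NeBot] (hτ : IsFaithfulTracialState τ) (hx : WeakTendsto τ f l x)
    (hy : WeakTendsto τ f l y) : x = y :=
  hτ.eq_of_forall fun b => tendsto_nhds_unique (hx b) (hy b)

theorem WeakTendsto.congr' (hx : WeakTendsto τ f l x) (h : f =ᶠ[l] g) : WeakTendsto τ g l x :=
  fun b => (hx b).congr' (h.mono fun i hi => by rw [hi])

theorem weakTendsto_const (x : N) : WeakTendsto τ (fun _ : ι => x) l x :=
  fun _ => tendsto_const_nhds

theorem WeakTendsto.add (hx : WeakTendsto τ f l x) (hy : WeakTendsto τ g l y) :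
    WeakTendsto τ (fun i => f i + g i) l (x + y) := fun b => by
  simpa [add_mul] using (hx b).add (hy b)

theorem WeakTendsto.sub (hx : WeakTendsto τ f l x) (hy : WeakTendsto τ g l y) :
    WeakTendsto τ (fun i => f i - g i) l (x - y) := fun b => by
  simpa [sub_mul] using (hx b).sub (hy b)

theorem WeakTendsto.mul_const (hx : WeakTendsto τ f l x) (c : N) :
    WeakTendsto τ (fun i => f i * c) l (x * c) := fun b => by
  simpa [mul_assoc] using hx (c * b)

theorem WeakTendsto.const_mul (hτ : IsFaithfulTracialState τ) (hx : WeakTendsto τ f l x) (c : N) :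
    WeakTendsto τ (fun i => c * f i) l (c * x) := fun b => by
  have h : ∀ z, τ (c * z * b) = τ (z * (b * c)) := fun z => by
    rw [mul_assoc, hτ.tracial, mul_assoc]
  simpa only [h] using hx (b * c)

theorem WeakTendsto.star (hτ : IsFaithfulTracialState τ) (hx : WeakTendsto τ f l x) :
    WeakTendsto τ (fun i => star (f i)) l (star x) := fun b => by
  have h : ∀ z, τ (Star.star z * b) = Star.star (τ (z * Star.star b)) := fun z => by
    rw [← hτ.map_star, star_mul, star_star, hτ.tracial]
  simp only [h]
  exact (continuous_star.tendsto _).comp (hx _)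

theorem WeakTendsto.tendsto (hx : WeakTendsto τ f l x) : Tendsto (fun i => τ (f i)) l (𝓝 (τ x)) := by
  simpa using hx 1

theorem weakTendsto_zero_of_l2Norm (hτ : IsFaithfulTracialState τ)
    (h : Tendsto (fun i => l2Norm τ (f i)) l (𝓝 0)) : WeakTendsto τ f l 0 := fun b => by
  rw [zero_mul, map_zero]
  refine squeeze_zero_norm (fun i => hτ.norm_map_mul_le' (f i) b) ?_
  simpa using h.mul_const (l2Norm τ b)

end WeakTendsto

/-! ### Order estimates and approximation by projections. -/

section CStar

variable {N : Type*} [CStarAlgebra N] {τ : N →ₗ[ℂ] ℂ} {B : StarSubalgebra ℂ N}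

theorem HasWeakLimits.exists_weakTendsto (hW : HasWeakLimits τ B) {ι : Type*} (U : Ultrafilter ι)
    {f : ι → N} {C : ℝ} (hf : ∀ᶠ i in (U : Filter ι), f i ∈ B ∧ ‖f i‖ ≤ C) :
    ∃ y ∈ B, ‖y‖ ≤ C ∧ WeakTendsto τ f U y := by
  obtain ⟨y, hy, hC, h⟩ := hW (U.map f) C hf
  exact ⟨y, hy, hC, fun b => h b⟩

section Order

variable [PartialOrder N] [StarOrderedRing N]

theorem norm_le_of_neg_le_of_le {a : N} (ha : IsSelfAdjoint a) {r : ℝ} (hr : 0 ≤ r)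
    (h1 : -algebraMap ℝ N r ≤ a) (h2 : a ≤ algebraMap ℝ N r) : ‖a‖ ≤ r := by
  rcases subsingleton_or_nontrivial N with h | h
  · rw [Subsingleton.elim a 0, norm_zero]; exact hr
  rcases CStarAlgebra.norm_or_neg_norm_mem_spectrum ha with h | h
  · exact (le_algebraMap_iff_spectrum_le ha).mp h2 _ h
  · rw [← map_neg] at h1
    have := (algebraMap_le_iff_le_spectrum ha).mp h1 _ h
    linarith

/-- For u = s*s and v = t*t, traciality gives τ(uv) = ‖s t*‖₂². -/
theorem IsFaithfulTracialState.re_mul_nonneg (hτ : IsFaithfulTracialState τ) {u v : N}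
    (hu : 0 ≤ u) (hv : 0 ≤ v) : 0 ≤ (τ (u * v)).re := by
  obtain ⟨s, rfl⟩ := CStarAlgebra.nonneg_iff_eq_star_mul_self.mp hu
  obtain ⟨t, rfl⟩ := CStarAlgebra.nonneg_iff_eq_star_mul_self.mp hv
  have h : τ (star s * s * (star t * t)) = τ (star (s * star t) * (s * star t)) := by
    rw [← mul_assoc, hτ.tracial, star_mul, star_star]
    simp only [mul_assoc]
  rw [h]
  exact hτ.nonneg_re _

/-- One step of the approximation of a self-adjoint element by projections. -/
theorem HasRangeProjections.exists_norm_sub_le (hR : HasRangeProjections B)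
    (hB : IsClosed (B : Set N)) {a : N} (haB : a ∈ B) (ha : IsSelfAdjoint a) {r : ℝ}
    (hr : ‖a‖ ≤ r) :
    ∃ q ∈ B, IsStarProjection q ∧ ‖a - ((r : ℂ) • q - ((r / 2 : ℝ) : ℂ) • 1)‖ ≤ r / 2 := by
  have hr0 : 0 ≤ r := (norm_nonneg a).trans hr
  have hpB : a⁺ ∈ B := by
    rw [CFC.posPart_def, cfcₙ_eq_cfc]
    exact cfc_mem (𝕜' := ℂ) (hs := hB) _ haB
  obtain ⟨q, hqB, hq, hqa, hz⟩ := hR _ hpB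
  have hnq : a⁻ * q = 0 := hz _ (CFC.negPart_mul_posPart a)
  have hp0 : 0 ≤ a⁺ := CFC.posPart_nonneg a
  have hn0 : 0 ≤ a⁻ := CFC.negPart_nonneg a
  have hpsa : star (a⁺) = a⁺ := (IsSelfAdjoint.of_nonneg hp0).star_eq
  have hnsa : star (a⁻) = a⁻ := (IsSelfAdjoint.of_nonneg hn0).star_eq
  have hqs : star q = q := hq.2
  have hqi : q * q = q := hq.1
  have haq : a⁺ * q = a⁺ := by
    have := congrArg star hqa
    rwa [star_mul, hqs, hpsa] at this
  have hqn : q * a⁻ = 0 := by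
    have := congrArg star hnq
    rwa [star_mul, hqs, hnsa, star_zero] at this
  -- As q is the range projection of a⁺, one has a⁺ ≤ r q and a⁻ ≤ r (1 - q), so a - (r q - r/2)
  -- lies between -r/2 and r/2.
  have h1 : a⁺ ≤ r • q := by
    have := CStarAlgebra.star_left_conjugate_le_norm_smul (a := q) (b := a⁺)
    rw [hqs, hqa, haq, hqi] at this
    exact this.trans (smul_le_smul_of_nonneg_right
      ((CStarAlgebra.norm_posPart_le a).trans hr) hq.nonneg)
  have h2 : a⁻ ≤ r • (1 - q) := by
    have := CStarAlgebra.star_left_conjugate_le_norm_smul (a := 1 - q) (b := a⁻)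
    rw [hq.one_sub.2, mul_sub, sub_mul, hqn, hq.one_sub.1, mul_one, one_mul, sub_zero,
      hnq, sub_zero] at this
    exact this.trans (smul_le_smul_of_nonneg_right
      ((CStarAlgebra.norm_negPart_le a).trans hr) hq.one_sub.nonneg)
  have h3 : a⁺ - a⁻ = a := CFC.posPart_sub_negPart a ha
  refine ⟨q, hqB, hq, norm_le_of_neg_le_of_le ?_ (by linarith) ?_ ?_⟩
  · refine ha.sub (IsSelfAdjoint.sub ?_ ?_)
    · rw [Complex.coe_smul]; exact (IsSelfAdjoint.all r).smul hq.2
    · rw [Complex.coe_smul]; exact (IsSelfAdjoint.all (r / 2)).smul (.one N)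
  · rw [Complex.coe_smul, Complex.coe_smul, Algebra.algebraMap_eq_smul_one, ← sub_nonneg]
    have : a - (r • q - (r / 2) • (1 : N)) - -((r / 2) • 1) = a⁺ + (r • (1 - q) - a⁻) := by
      generalize a⁺ = u, a⁻ = v at h3
      rw [← h3]
      module
    rw [this]
    exact add_nonneg hp0 (sub_nonneg.mpr h2)
  · rw [Complex.coe_smul, Complex.coe_smul, Algebra.algebraMap_eq_smul_one, ← sub_nonneg]
    have : (r / 2) • (1 : N) - (a - (r • q - (r / 2) • (1 : N))) = a⁻ + (r • q - a⁺) := by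
      generalize a⁺ = u, a⁻ = v at h3
      rw [← h3]
      module
    rw [this]
    exact add_nonneg hn0 (sub_nonneg.mpr h1)

end Order

theorem _root_.StarSubalgebra.mem_of_isSelfAdjoint_mem (B : StarSubalgebra ℂ N)
    (S : Submodule ℂ N) (hsa : ∀ a ∈ B, IsSelfAdjoint a → a ∈ S) : ∀ a ∈ B, a ∈ S := by
  intro a haB
  rw [← realPart_add_I_smul_imaginaryPart a]
  have hre : (realPart a : N) ∈ B := by
    rw [realPart_apply_coe, ← Complex.coe_smul]
    exact B.smul_mem (add_mem haB (star_mem haB)) _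
  have him : (imaginaryPart a : N) ∈ B := by
    rw [imaginaryPart_apply_coe, ← Complex.coe_smul]
    exact B.smul_mem (B.smul_mem (sub_mem haB (star_mem haB)) _) _
  exact add_mem (hsa _ hre (realPart a).2) (S.smul_mem _ (hsa _ him (imaginaryPart a).2))

/-- A closed subspace that contains the projections of `B` contains `B`. -/
theorem HasRangeProjections.mem_of_forall_projection (hR : HasRangeProjections B)
    (hB : IsClosed (B : Set N)) (S : Submodule ℂ N) (hS : IsClosed (S : Set N))
    (hqS : ∀ q ∈ B, IsStarProjection q → q ∈ S) : ∀ a ∈ B, a ∈ S := by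
  let _ := CStarAlgebra.spectralOrder N
  have _ := CStarAlgebra.spectralOrderedRing N
  have h1 : (1 : N) ∈ S := hqS 1 (one_mem B) (.one N)
  -- Applying the one-step approximation to the remainder a - s halves the error bound each time.
  have hstep : ∀ a ∈ B, IsSelfAdjoint a → ∀ k : ℕ, ∃ s ∈ S, s ∈ B ∧ IsSelfAdjoint s ∧
      ‖a - s‖ ≤ ‖a‖ * (1 / 2) ^ k := by
    intro a haB ha k
    induction k with
    | zero => exact ⟨0, zero_mem S, zero_mem B, .zero N, by simp⟩
    | succ k ih =>
      obtain ⟨s, hsS, hsB, hs, hk⟩ := ih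
      obtain ⟨q, hqB, hq, hle⟩ := hR.exists_norm_sub_le hB (sub_mem haB hsB) (ha.sub hs) hk
      set r := ‖a‖ * (1 / 2) ^ k with hr
      refine ⟨s + ((r : ℂ) • q - ((r / 2 : ℝ) : ℂ) • 1), ?_, ?_, ?_, ?_⟩
      · exact add_mem hsS (sub_mem (S.smul_mem _ (hqS q hqB hq)) (S.smul_mem _ h1))
      · exact add_mem hsB (sub_mem (B.smul_mem hqB _) (B.smul_mem (one_mem B) _))
      · refine hs.add (IsSelfAdjoint.sub ?_ ?_)
        · rw [Complex.coe_smul]; exact (IsSelfAdjoint.all r).smul hq.2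
        · rw [Complex.coe_smul]; exact (IsSelfAdjoint.all (r / 2)).smul (.one N)
      · rw [← sub_sub]
        refine hle.trans (le_of_eq ?_)
        rw [hr, pow_succ]; ring
  have hsa : ∀ a ∈ B, IsSelfAdjoint a → a ∈ S := by
    intro a haB ha
    choose s hsS _ _ hs using hstep a haB ha
    refine hS.mem_of_tendsto (f := s) (b := atTop) ?_ (Eventually.of_forall hsS)
    rw [tendsto_iff_norm_sub_tendsto_zero]
    refine squeeze_zero (fun _ => norm_nonneg _) (fun k => (norm_sub_rev _ _).le.trans (hs k)) ?_
    simpa using (tendsto_pow_atTop_nhds_zero_of_lt_one (r := (1 / 2 : ℝ)) (by norm_num)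
      (by norm_num)).const_mul ‖a‖
  exact B.mem_of_isSelfAdjoint_mem S hsa

end CStar

/-! ### Conditional expectations as nearest points. -/

section Expectation

variable {N : Type*} [CStarAlgebra N] {τ : N →ₗ[ℂ] ℂ} {B : StarSubalgebra ℂ N}

theorem IsFaithfulTracialState.l2Norm_sq_sub (hτ : IsFaithfulTracialState τ) {u v : N}
    (hu : IsSelfAdjoint u) (hv : IsSelfAdjoint v) :
    l2Norm τ (u - v) ^ 2 = l2Norm τ u ^ 2 - 2 * (τ (u * v)).re + l2Norm τ v ^ 2 := by
  simp only [hτ.l2Norm_sq, star_sub, hu.star_eq, hv.star_eq, sub_mul, mul_sub, map_sub,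
    Complex.sub_re]
  rw [hτ.tracial v u]
  ring

/-- A minimising sequence in the ball has a weak limit a, and the 2-norm is weakly lower
semicontinuous: ‖x - a‖₂² is the limit of |τ((x - f n)(x - a)*)| ≤ ‖x - f n‖₂ ‖x - a‖₂. This
replaces completeness of L². -/
theorem HasWeakLimits.exists_l2Norm_sub_le (hW : HasWeakLimits τ B)
    (hτ : IsFaithfulTracialState τ) {x : N} {R : ℝ} (hR : 0 ≤ R) :
    ∃ a ∈ B, IsSelfAdjoint a ∧ ‖a‖ ≤ R ∧
      ∀ c ∈ B, IsSelfAdjoint c → ‖c‖ ≤ R → l2Norm τ (x - a) ≤ l2Norm τ (x - c) := by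
  let S : Set ℝ := (fun c => l2Norm τ (x - c)) '' {c | c ∈ B ∧ IsSelfAdjoint c ∧ ‖c‖ ≤ R}
  have hSne : S.Nonempty := ⟨_, 0, ⟨zero_mem B, .zero N, by simpa using hR⟩, rfl⟩
  have hSb : BddBelow S := ⟨0, by rintro _ ⟨c, _, rfl⟩; exact l2Norm_nonneg _ _⟩
  obtain ⟨u, -, hu, huS⟩ := exists_seq_tendsto_sInf hSne hSb
  choose f hf hfu using huS
  obtain ⟨a, haB, haR, ha⟩ := hW.exists_weakTendsto (hyperfilter ℕ) (f := f) (C := R)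
    (Eventually.of_forall fun n => ⟨(hf n).1, (hf n).2.2⟩)
  have hsa : IsSelfAdjoint a := (ha.star hτ).unique hτ
    (ha.congr' (Eventually.of_forall fun n => ((hf n).2.1.star_eq).symm))
  refine ⟨a, haB, hsa, haR, fun c hcB hc hcR => ?_⟩
  refine le_trans ?_ (csInf_le hSb ⟨c, ⟨hcB, hc, hcR⟩, rfl⟩)
  have h1 : Tendsto (fun n => ‖τ ((x - f n) * star (x - a))‖) (hyperfilter ℕ)
      (𝓝 (l2Norm τ (x - a) * l2Norm τ (x - a))) := by
    have := (((weakTendsto_const x).sub ha) (star (x - a))).norm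
    rwa [hτ.tracial, ← hτ.ofReal_l2Norm_sq, Complex.norm_real, Real.norm_eq_abs, abs_sq,
      pow_two] at this
  have h2 : Tendsto (fun n => u n * l2Norm τ (x - a)) (hyperfilter ℕ)
      (𝓝 (sInf S * l2Norm τ (x - a))) :=
    (hu.mono_left Nat.hyperfilter_le_atTop).mul_const _
  have h3 := le_of_tendsto_of_tendsto' h1 h2 fun n => by
    refine (hτ.norm_map_mul_le' _ _).trans (le_of_eq ?_)
    rw [hτ.star_swap, ← hfu n]
  rcases (l2Norm_nonneg τ (x - a)).eq_or_lt with h0 | h0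
  · rw [← h0]
    exact le_csInf hSne (by rintro _ ⟨c, _, rfl⟩; exact l2Norm_nonneg _ _)
  · exact le_of_mul_le_mul_right h3 h0

/-- Truncation of a self-adjoint `a` at height `r ≥ ‖x‖` brings it closer to `x`. -/
theorem IsFaithfulTracialState.exists_truncation (hτ : IsFaithfulTracialState τ)
    (hB : IsClosed (B : Set N)) {x a : N} (hx : IsSelfAdjoint x) (haB : a ∈ B)
    (ha : IsSelfAdjoint a) :
    ∃ c ∈ B, IsSelfAdjoint c ∧ ‖c‖ ≤ ‖x‖ ∧
      l2Norm τ (x - c) ^ 2 + l2Norm τ (a - c) ^ 2 ≤ l2Norm τ (x - a) ^ 2 := by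
  let _ := CStarAlgebra.spectralOrder N
  have _ := CStarAlgebra.spectralOrderedRing N
  set r := ‖x‖ with hr
  have hr0 : 0 ≤ r := norm_nonneg x
  let k : ℝ → ℝ := fun t => max (-r) (min t r)
  let f₁ : ℝ → ℝ := fun t => max (t - r) 0
  let f₂ : ℝ → ℝ := fun t => max (-t - r) 0
  have hk : Continuous k := by fun_prop
  have hf₁ : Continuous f₁ := by fun_prop
  have hf₂ : Continuous f₂ := by fun_prop
  set c := cfc k a with hc
  set c₁ := cfc f₁ a with hc₁
  set c₂ := cfc f₂ a with hc₂
  have hcs : IsSelfAdjoint c := cfc_predicate k a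
  have e1 : a - c = c₁ - c₂ := by
    have h0 : a - c = cfc (fun t : ℝ => t) a - cfc k a := by rw [cfc_id' ℝ a]
    rw [h0, hc₁, hc₂, ← cfc_sub f₁ f₂ a, ← cfc_sub (fun t => t) k a]
    · refine cfc_congr fun t _ => ?_
      simp only [k, f₁, f₂]
      rcases le_total t r with h | h
      · rcases le_total (-r) t with h' | h'
        · rw [min_eq_left h, max_eq_right h', max_eq_right (by linarith : t - r ≤ 0),
            max_eq_right (by linarith : -t - r ≤ 0)]
          ring
        · rw [min_eq_left h, max_eq_left h', max_eq_right (by linarith : t - r ≤ 0),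
            max_eq_left (by linarith : 0 ≤ -t - r)]
          ring
      · rw [min_eq_right h, max_eq_right (by linarith : -r ≤ r),
          max_eq_left (by linarith : 0 ≤ t - r), max_eq_right (by linarith : -t - r ≤ 0)]
        ring
  -- The truncation c equals r where c₁ is non-zero and -r where c₂ is.
  have e2 : c * (c₁ - c₂) = r • (c₁ + c₂) := by
    rw [hc, hc₁, hc₂, ← cfc_sub f₁ f₂ a, ← cfc_add a f₁ f₂, ← cfc_mul k _ a, ← cfc_smul r _ a]
    · refine cfc_congr fun t _ => ?_
      simp only [k, f₁, f₂, smul_eq_mul]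
      rcases le_total t r with h | h
      · rcases le_total (-r) t with h' | h'
        · rw [max_eq_right (by linarith : t - r ≤ 0), max_eq_right (by linarith : -t - r ≤ 0)]
          ring
        · rw [min_eq_left h, max_eq_left h', max_eq_right (by linarith : t - r ≤ 0)]
          ring
      · rw [min_eq_right h, max_eq_right (by linarith : -r ≤ r),
          max_eq_right (by linarith : -t - r ≤ 0)]
        ring
  have h1 : 0 ≤ c₁ := cfc_nonneg fun t _ => le_max_right _ _
  have h2 : 0 ≤ c₂ := cfc_nonneg fun t _ => le_max_right _ _
  have hxle : 0 ≤ algebraMap ℝ N r - x := sub_nonneg.mpr hx.le_algebraMap_norm_self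
  have hxge : 0 ≤ algebraMap ℝ N r + x := by
    have := hx.neg_algebraMap_norm_le_self
    rw [← sub_nonneg] at this
    rwa [add_comm, ← sub_neg_eq_add]
  -- By `e2`, the cross term τ((x - c)(a - c)) equals -τ((r - x)c₁) - τ((r + x)c₂), and these two
  -- inequalities make it nonpositive.
  have t1 := hτ.re_mul_nonneg hxle h1
  have t2 := hτ.re_mul_nonneg hxge h2
  refine ⟨c, cfc_mem (𝕜' := ℂ) (hs := hB) _ haB, hcs, norm_cfc_le hr0 fun t _ => ?_, ?_⟩
  · rw [Real.norm_eq_abs, abs_le]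
    exact ⟨le_max_left _ _, max_le (by linarith) (min_le_right _ _)⟩
  · have e3 : x - a = (x - c) - (c₁ - c₂) := by rw [← e1]; abel
    have hds : IsSelfAdjoint (c₁ - c₂) := e1 ▸ ha.sub hcs
    rw [e3, e1, hτ.l2Norm_sq_sub (hx.sub hcs) hds, sub_mul, e2]
    simp only [Algebra.algebraMap_eq_smul_one, sub_mul, add_mul, smul_mul_assoc, one_mul, mul_sub,
      smul_add, map_sub, map_add, ← Complex.coe_smul r, map_smul, Complex.sub_re,
      Complex.add_re, smul_eq_mul, Complex.re_ofReal_mul] at t1 t2 ⊢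
    linarith

/-- The nearest point to x is sought in the ball of radius ‖x‖ + 1. Truncation shows that its norm
is at most ‖x‖, so it can be perturbed in every direction of B, and the first variation gives
orthogonality. -/
theorem HasWeakLimits.exists_expectation_of_isSelfAdjoint (hW : HasWeakLimits τ B)
    (hτ : IsFaithfulTracialState τ) (hB : IsClosed (B : Set N)) {x : N} (hx : IsSelfAdjoint x) :
    ∃ y ∈ B, IsSelfAdjoint y ∧ ‖y‖ ≤ ‖x‖ ∧ ∀ b ∈ B, τ (y * b) = τ (x * b) := by
  obtain ⟨a, haB, ha, -, hmin⟩ := hW.exists_l2Norm_sub_le hτ (x := x) (R := ‖x‖ + 1)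
    (by positivity)
  obtain ⟨c, hcB, hc, hcn, hle⟩ := hτ.exists_truncation hB hx haB ha
  have h1 := hmin c hcB hc (by linarith)
  have h2 : l2Norm τ (a - c) = 0 := by
    have := pow_le_pow_left₀ (l2Norm_nonneg _ _) h1 2
    nlinarith [l2Norm_nonneg τ (a - c)]
  obtain rfl : a = c := sub_eq_zero.mp (hτ.eq_zero_of_l2Norm h2)
  have hre : ∀ b ∈ B, IsSelfAdjoint b → (τ ((x - a) * b)).re = 0 := by
    intro b hbB hb
    set s := (τ ((x - a) * b)).re with hs
    have key : ∀ t : ℝ, |t| * ‖b‖ ≤ 1 → 0 ≤ -2 * (t * s) + t ^ 2 * l2Norm τ b ^ 2 := by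
      intro t ht
      have htb : IsSelfAdjoint ((t : ℂ) • b) := by
        rw [Complex.coe_smul]; exact (IsSelfAdjoint.all t).smul hb
      have h3 := hmin (a + (t : ℂ) • b) (add_mem haB (B.smul_mem hbB _)) (ha.add htb) (by
        refine (norm_add_le _ _).trans (add_le_add hcn ?_)
        rwa [norm_smul, Complex.norm_real, Real.norm_eq_abs])
      rw [← sub_sub] at h3
      have h4 := pow_le_pow_left₀ (l2Norm_nonneg _ _) h3 2
      rw [hτ.l2Norm_sq_sub (hx.sub ha) htb, mul_smul_comm, map_smul, smul_eq_mul,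
        Complex.re_ofReal_mul, hτ.l2Norm_sq ((t : ℂ) • b), star_smul, smul_mul_smul_comm,
        map_smul, Complex.star_def, Complex.conj_ofReal, ← Complex.ofReal_mul, smul_eq_mul,
        Complex.re_ofReal_mul, ← hτ.l2Norm_sq b] at h4
      nlinarith
    by_contra hs0
    set β := l2Norm τ b ^ 2 with hβ
    have hβ0 : 0 ≤ β := sq_nonneg _
    have hD : 0 < 1 + β + |s| * ‖b‖ := by positivity
    -- The step t = s η is admissible as |t|‖b‖ ≤ 1, and short enough that the linear term wins:
    -- -2s²η + s²η²β ≤ -s²η < 0 for s ≠ 0.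
    set η := (1 + β + |s| * ‖b‖)⁻¹ with hη
    have hη0 : 0 < η := inv_pos.mpr hD
    have hηD : η * (1 + β + |s| * ‖b‖) = 1 := inv_mul_cancel₀ hD.ne'
    have h5 := key (s * η) (by
      rw [abs_mul, abs_of_pos hη0]
      nlinarith [mul_nonneg hη0.le hβ0])
    have h6 : 0 < s ^ 2 := by positivity
    have h7 : η * β ≤ 1 := by nlinarith [mul_nonneg hη0.le (mul_nonneg (abs_nonneg s) (norm_nonneg b))]
    have h8 : 0 < s ^ 2 * η := mul_pos h6 hη0
    nlinarith [mul_le_mul_of_nonneg_left h7 h8.le]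
  have hker : ∀ b ∈ B, b ∈ LinearMap.ker (τ ∘ₗ LinearMap.mulLeft ℂ (x - a)) := by
    refine B.mem_of_isSelfAdjoint_mem _ fun b hbB hb => ?_
    rw [LinearMap.mem_ker]
    refine Complex.ext (hre b hbB hb) ?_
    refine Complex.conj_eq_iff_im.mp ?_
    change star (τ ((x - a) * b)) = τ ((x - a) * b)
    rw [← hτ.map_star, star_mul, hb.star_eq, (hx.sub ha).star_eq, hτ.tracial]
  refine ⟨a, haB, ha, hcn, fun b hb => ?_⟩
  have := hker b hb
  rw [LinearMap.mem_ker, LinearMap.comp_apply, LinearMap.mulLeft_apply, sub_mul, map_sub,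
    sub_eq_zero] at this
  exact this.symm

/-- Real and imaginary parts are treated separately, whence the factor 2. Only boundedness matters
later, so that termwise expectations of a bounded sequence remain bounded. -/
theorem HasWeakLimits.exists_expectation (hW : HasWeakLimits τ B)
    (hτ : IsFaithfulTracialState τ) (hB : IsClosed (B : Set N)) (x : N) :
    ∃ y ∈ B, ‖y‖ ≤ 2 * ‖x‖ ∧ ∀ b ∈ B, τ (y * b) = τ (x * b) := by
  obtain ⟨u, huB, -, hun, hu⟩ := hW.exists_expectation_of_isSelfAdjoint hτ hB (realPart x).2
  obtain ⟨v, hvB, -, hvn, hv⟩ := hW.exists_expectation_of_isSelfAdjoint hτ hB (imaginaryPart x).2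
  refine ⟨u + Complex.I • v, add_mem huB (B.smul_mem hvB _), ?_, fun b hb => ?_⟩
  · refine (norm_add_le _ _).trans ?_
    rw [norm_smul, Complex.norm_I, one_mul]
    have h1 := realPart.norm_le x
    have h2 := imaginaryPart.norm_le x
    have h3 : ‖(realPart x : N)‖ ≤ ‖x‖ := h1
    have h4 : ‖(imaginaryPart x : N)‖ ≤ ‖x‖ := h2
    linarith
  · conv_rhs => rw [← realPart_add_I_smul_imaginaryPart x]
    rw [add_mul, add_mul, map_add, map_add, hu b hb, smul_mul_assoc, smul_mul_assoc, map_smul,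
      map_smul, hv b hb]

end Expectation

/-! ### Greedy colouring of a weighted graph. -/

section Coloring

/-- A colouring of the vertices of a weighted complete graph with `n` colours, such that at most
one `n`-th of the weight is on monochromatic edges. -/
theorem exists_coloring_sum_le {n : ℕ} (hn : 0 < n) :
    ∀ (k : ℕ) (ν : Fin k → Fin k → ℝ), (∀ i, 0 ≤ ν i i) → ∃ f : Fin k → Fin n,
      n * ∑ i, ∑ j, (if f i = f j then ν i j else 0) ≤ n * ∑ i, ν i i + ∑ i, ∑ j, ν i j := by
  intro k
  induction k with
  | zero => exact fun ν _ => ⟨fun i => i.elim0, by simp⟩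
  | succ k ih =>
    intro ν hν
    obtain ⟨f, hf⟩ := ih (fun i j => ν i.castSucc j.castSucc) fun i => hν _
    let w : Fin k → ℝ := fun i => ν i.castSucc (Fin.last k) + ν (Fin.last k) i.castSucc
    have : Nonempty (Fin n) := ⟨⟨0, hn⟩⟩
    -- The last vertex receives a colour whose weight towards the vertices already coloured is at
    -- most the average over the n colours.
    obtain ⟨c, -, hc⟩ := Finset.exists_le_of_sum_le (s := (Finset.univ : Finset (Fin n)))
      (f := fun c => n * ∑ i, (if f i = c then w i else 0)) (g := fun _ => ∑ i, w i)
      Finset.univ_nonempty (by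
        rw [← Finset.mul_sum, Finset.sum_comm]
        simp)
    refine ⟨Fin.snoc f c, ?_⟩
    -- The right-hand side counts this diagonal weight once more, in the total sum, so its sign
    -- matters.
    have hl : ν (Fin.last k) (Fin.last k) ≥ 0 := hν _
    simp only [Fin.sum_univ_castSucc, Fin.snoc_castSucc, Fin.snoc_last, if_true,
      Finset.sum_add_distrib, w, mul_add, ite_add_zero] at hc hf ⊢
    simp only [@eq_comm _ c] at hc hf ⊢
    linarith

end Coloring

/-! ### Pinchings by partitions, and the upper bound in M. -/

section Pinching

variable {N : Type*} [CStarAlgebra N] {τ : N →ₗ[ℂ] ℂ} {B : StarSubalgebra ℂ N}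

/-- The product y*y of the pinching y = ∑ p i x p i is ∑ p i (x* p i x) p i, and each x* p i x is at
most ‖x‖². The bound makes weak limits of pinchings available. -/
theorem IsPartition.norm_sum_le (hτ : IsFaithfulTracialState τ) {k : ℕ} {p : Fin k → N}
    (hp : IsPartition B p) (x : N) : ‖∑ i, p i * x * p i‖ ≤ ‖x‖ := by
  let _ := CStarAlgebra.spectralOrder N
  have _ := CStarAlgebra.spectralOrderedRing N
  have hs : ∀ i, star (p i) = p i := fun i => (hp.isStarProjection i).2
  have hi : ∀ i, p i * p i = p i := fun i => (hp.isStarProjection i).1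
  have ho : ∀ i j, i ≠ j → p i * p j = 0 := fun i j hij =>
    hτ.mul_eq_zero_of_sum_eq_one hp.isStarProjection hp.sum_eq_one hij
  have h1 : star (∑ i, p i * x * p i) * ∑ i, p i * x * p i
      = ∑ i, p i * (star x * p i * x) * p i := by
    rw [star_sum, Finset.sum_mul_sum]
    refine Finset.sum_congr rfl fun i _ => ?_
    rw [Finset.sum_eq_single i]
    · rw [star_mul, star_mul, hs]
      calc _ = p i * star x * (p i * p i) * x * p i := by simp only [mul_assoc]
        _ = _ := by rw [hi]; simp only [mul_assoc]
    · intro j _ hj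
      calc _ = p i * star x * (p i * p j) * x * p j := by simp only [star_mul, hs, mul_assoc]
        _ = 0 := by rw [ho i j hj.symm]; simp
    · simp
  have h2 : star (∑ i, p i * x * p i) * ∑ i, p i * x * p i ≤ algebraMap ℝ N (‖x‖ ^ 2) := by
    rw [h1]
    calc ∑ i, p i * (star x * p i * x) * p i
        ≤ ∑ i, p i * algebraMap ℝ N (‖x‖ ^ 2) * p i := by
          refine Finset.sum_le_sum fun i _ => ?_
          have h3 : star x * p i * x ≤ algebraMap ℝ N (‖x‖ ^ 2) := by
            refine le_trans ?_ (CStarAlgebra.star_mul_le_algebraMap_norm_sq (a := x))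
            have := star_left_conjugate_le_conjugate (hp.isStarProjection i).le_one x
            rwa [mul_one] at this
          have := star_left_conjugate_le_conjugate h3 (p i)
          rwa [hs] at this
      _ = algebraMap ℝ N (‖x‖ ^ 2) := by
          simp_rw [← Algebra.commutes, mul_assoc, hi]
          rw [← Finset.mul_sum, hp.sum_eq_one, mul_one]
  have h4 := (CStarAlgebra.norm_le_iff_le_algebraMap _ (sq_nonneg ‖x‖)
    (star_mul_self_nonneg _)).mpr h2
  rw [CStarRing.norm_star_mul_self, ← pow_two] at h4
  exact le_of_sq_le_sq h4 (norm_nonneg _)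

/-- Pinching is an orthogonal projection for the 2-norm, so the image y of x satisfies ⟨y, y⟩ = ⟨y,
x⟩. The matching Pythagoras identity is `IsPartition.l2Norm_sub_sq`. -/
theorem IsPartition.l2Norm_sq_eq (hτ : IsFaithfulTracialState τ) {k : ℕ} {p : Fin k → N}
    (hp : IsPartition B p) (x : N) :
    l2Norm τ (∑ i, p i * x * p i) ^ 2 = (τ (star (∑ i, p i * x * p i) * x)).re := by
  rw [hτ.l2Norm_sq_sum hp.isStarProjection fun i j hij =>
    hτ.mul_eq_zero_of_sum_eq_one hp.isStarProjection hp.sum_eq_one hij]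
  rw [star_sum, Finset.sum_mul, map_sum, Complex.re_sum]
  refine Finset.sum_congr rfl fun i _ => ?_
  rw [star_mul, star_mul, (hp.isStarProjection i).2.star_eq, mul_assoc (p i)]

theorem IsPartition.l2Norm_sub_sq (hτ : IsFaithfulTracialState τ) {k : ℕ} {p : Fin k → N}
    (hp : IsPartition B p) (x : N) :
    l2Norm τ (∑ i, p i * x * p i - x) ^ 2
      = l2Norm τ x ^ 2 - l2Norm τ (∑ i, p i * x * p i) ^ 2 := by
  have h1 := hp.l2Norm_sq_eq hτ x
  have h2 := hτ.l2Norm_sq (∑ i, p i * x * p i)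
  set y := ∑ i, p i * x * p i
  have h3 : τ (star x * y) = star (τ (star y * x)) := by
    rw [← hτ.map_star, star_mul, star_star]
  rw [hτ.l2Norm_sq (y - x), star_sub, sub_mul, mul_sub, mul_sub, map_sub, map_sub, map_sub, h3,
    hτ.l2Norm_sq x]
  simp only [Complex.sub_re, Complex.star_def, Complex.conj_re]
  linarith

theorem isPartition_pair {q : N} (hqB : q ∈ B) (hq : IsStarProjection q) :
    IsPartition B ![q, 1 - q] where
  isStarProjection i := by fin_cases i <;> simp [hq, hq.one_sub]
  mem i := by
    fin_cases i
    · exact hqB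
    · exact sub_mem (one_mem B) hqB
  sum_eq_one := by simp

/-- The common refinement of two commuting partitions. -/
theorem IsPartition.mul (hc : ∀ x ∈ B, ∀ y ∈ B, x * y = y * x) {k l : ℕ} {p : Fin k → N}
    {q : Fin l → N} (hp : IsPartition B p) (hq : IsPartition B q) :
    IsPartition B fun i => p (finProdFinEquiv.symm i).1 * q (finProdFinEquiv.symm i).2 where
  isStarProjection i := (hp.isStarProjection _).mul (hq.isStarProjection _)
    (hc _ (hp.mem _) _ (hq.mem _))
  mem i := mul_mem (hp.mem _) (hq.mem _)
  sum_eq_one := by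
    rw [Equiv.sum_comp finProdFinEquiv.symm (fun i => p i.1 * q i.2), Fintype.sum_prod_type]
    simp_rw [← Finset.mul_sum, hq.sum_eq_one, mul_one, hp.sum_eq_one]

/-- Refining a partition amounts to one more pinching, so that Pythagoras applies between a
partition and its refinement. -/
theorem IsPartition.sum_mul (hc : ∀ x ∈ B, ∀ y ∈ B, x * y = y * x) {k l : ℕ} {p : Fin k → N}
    {q : Fin l → N} (hp : IsPartition B p) (hq : IsPartition B q) (x : N) :
    ∑ i, p (finProdFinEquiv.symm i).1 * q (finProdFinEquiv.symm i).2 * x *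
      (p (finProdFinEquiv.symm i).1 * q (finProdFinEquiv.symm i).2)
      = ∑ j, q j * (∑ i, p i * x * p i) * q j := by
  rw [Equiv.sum_comp finProdFinEquiv.symm (fun i => p i.1 * q i.2 * x * (p i.1 * q i.2)),
    Fintype.sum_prod_type, Finset.sum_comm]
  refine Finset.sum_congr rfl fun j _ => ?_
  rw [Finset.mul_sum, Finset.sum_mul]
  refine Finset.sum_congr rfl fun i _ => ?_
  rw [hc _ (hp.mem i) _ (hq.mem j)]
  nth_rw 2 [← hc _ (hp.mem i) _ (hq.mem j)]
  simp only [mul_assoc]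

/-- Elements without expectation onto a maximal abelian subalgebra are paved in the `2`-norm. -/
theorem HasWeakLimits.exists_partition_l2Norm_lt (hW : HasWeakLimits τ (⊤ : StarSubalgebra ℂ N))
    (hτ : IsFaithfulTracialState τ) (hR : HasRangeProjections B) (hB : IsClosed (B : Set N))
    (hc : ∀ x ∈ B, ∀ y ∈ B, x * y = y * x) (hmax : ∀ z, (∀ b ∈ B, z * b = b * z) → z ∈ B)
    {x : N} (hx : ∀ b ∈ B, τ (x * b) = 0) {δ : ℝ} (hδ : 0 < δ) :
    ∃ (k : ℕ) (p : Fin k → N), IsPartition B p ∧ l2Norm τ (∑ i, p i * x * p i) ^ 2 < δ := by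
  let S : Set ℝ := {r | ∃ (k : ℕ) (p : Fin k → N), IsPartition B p ∧
    l2Norm τ (∑ i, p i * x * p i) ^ 2 = r}
  have hSne : S.Nonempty := ⟨_, 2, _, isPartition_pair (one_mem B) (.one N), rfl⟩
  have hSb : BddBelow S := ⟨0, by rintro _ ⟨k, p, _, rfl⟩; exact sq_nonneg _⟩
  obtain ⟨u, -, hu, huS⟩ := exists_seq_tendsto_sInf hSne hSb
  choose k p hp hpu using huS
  obtain ⟨y, -, -, hy⟩ := hW.exists_weakTendsto (hyperfilter ℕ) (C := ‖x‖)
    (f := fun n => ∑ i, p n i * x * p n i)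
    (Eventually.of_forall fun n => ⟨trivial, (hp n).norm_sum_le hτ x⟩)
  have hu' : Tendsto u (hyperfilter ℕ) (𝓝 (sInf S)) := hu.mono_left Nat.hyperfilter_le_atTop
  -- A further pinching by q and 1 - q cannot bring the squared norm below the infimum, so by
  -- Pythagoras it moves the nth term by at most √(u n - sInf S). In the limit y = q y q + (1 - q) y
  -- (1 - q).
  have hcomm : ∀ q ∈ B, IsStarProjection q → y * q = q * y := by
    intro q hqB hq
    have hpair := isPartition_pair hqB hq
    have h1 : Tendsto (fun n => l2Norm τ (∑ j, ![q, 1 - q] j * (∑ i, p n i * x * p n i) *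
        ![q, 1 - q] j - ∑ i, p n i * x * p n i)) (hyperfilter ℕ) (𝓝 0) := by
      have h2 : Tendsto (fun n => √(u n - sInf S)) (hyperfilter ℕ) (𝓝 0) := by
        simpa using (hu'.sub_const (sInf S)).sqrt
      refine squeeze_zero (fun n => l2Norm_nonneg _ _) (fun n => ?_) h2
      refine Real.le_sqrt_of_sq_le ?_
      rw [hpair.l2Norm_sub_sq hτ, hpu n]
      have := csInf_le hSb ⟨_, _, (hp n).mul hc hpair, rfl⟩
      rw [(hp n).sum_mul hc hpair] at this
      linarith
    have h2 := weakTendsto_zero_of_l2Norm hτ h1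
    simp only [Fin.sum_univ_two, Matrix.cons_val_zero, Matrix.cons_val_one] at h2
    have h3 := ((((hy.const_mul hτ q).mul_const q).add
      ((hy.const_mul hτ (1 - q)).mul_const (1 - q))).sub hy).unique hτ h2
    have hqi : q * q = q := hq.1
    have e1 := congrArg (fun z => q * z) h3
    have e2 := congrArg (fun z => z * q) h3
    simp only [mul_add, add_mul, mul_sub, sub_mul, mul_one, one_mul, mul_zero, zero_mul, hqi,
      ← mul_assoc] at e1 e2
    simp only [mul_assoc, hqi] at e1 e2
    have e3 : q * y = q * (y * q) := by
      rw [← sub_eq_zero, ← neg_eq_zero, ← e1]; abel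
    have e4 : y * q = q * (y * q) := by
      rw [← sub_eq_zero, ← neg_eq_zero, ← e2]; abel
    exact e4.trans e3.symm
  have hcl : IsClosed {b | y * b = b * y} := isClosed_eq (by fun_prop) (by fun_prop)
  have hyB : y ∈ B := by
    refine hmax y fun b hb => ?_
    have hcl' : IsClosed (LinearMap.ker (LinearMap.mulLeft ℂ y - LinearMap.mulRight ℂ y) : Set N) := by
      convert hcl using 1
      ext b
      simp [sub_eq_zero]
    have h := hR.mem_of_forall_projection hB _ hcl'
      (fun q hqB hq => by simp [hcomm q hqB hq]) b hb
    simpa [sub_eq_zero] using h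
  have hzero : ∀ b ∈ B, ∀ n, τ ((∑ i, p n i * x * p n i) * b) = 0 := by
    intro b hb n
    rw [← hx b hb, Finset.sum_mul, map_sum]
    have : ∀ i, τ (p n i * x * p n i * b) = τ (x * (b * p n i)) := fun i => by
      rw [mul_assoc, hc _ ((hp n).mem i) _ hb, mul_assoc, hτ.tracial, mul_assoc, mul_assoc,
        ((hp n).isStarProjection i).1]
    simp_rw [this]
    rw [← map_sum, ← Finset.mul_sum, ← Finset.mul_sum, (hp n).sum_eq_one, mul_one]
  have hy0 : y = 0 := by
    refine hτ.faithful _ ?_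
    rw [hτ.tracial]
    refine tendsto_nhds_unique (hy (star y)) ?_
    simp_rw [hzero _ (star_mem hyB)]
    exact tendsto_const_nhds
  subst hy0
  -- Weak convergence of the pinchings to 0 suffices, because u n is the trace of the adjoint of the
  -- nth pinching times the fixed x.
  have h5 : Tendsto u (hyperfilter ℕ) (𝓝 0) := by
    have h6 := (Complex.continuous_re.tendsto _).comp ((hy.star hτ) x)
    rw [star_zero, zero_mul, map_zero, Complex.zero_re] at h6
    exact h6.congr fun n => by rw [← hpu n, (hp n).l2Norm_sq_eq hτ]; rfl
  obtain ⟨n, hn⟩ := (h5.eventually_lt_const hδ).exists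
  exact ⟨k n, p n, hp n, (hpu n).trans_lt hn⟩

/-- Colour the pieces with weights τ(q i x* q j x) = ‖q j x q i‖₂² and add up each colour class. The
diagonal weights add up to the pinching by q, all weights to ‖x‖₂², and the monochromatic ones to
the new pinching. -/
theorem IsPartition.exists_merge (hτ : IsFaithfulTracialState τ) {k n : ℕ} (hn : 0 < n)
    {q : Fin k → N} (hq : IsPartition B q) (x : N) :
    ∃ p : Fin n → N, IsPartition B p ∧ n * l2Norm τ (∑ i, p i * x * p i) ^ 2
      ≤ n * l2Norm τ (∑ i, q i * x * q i) ^ 2 + l2Norm τ x ^ 2 := by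
  have hs : ∀ i, star (q i) = q i := fun i => (hq.isStarProjection i).2
  have hi : ∀ i, q i * q i = q i := fun i => (hq.isStarProjection i).1
  have ho : ∀ i j, i ≠ j → q i * q j = 0 := fun i j hij =>
    hτ.mul_eq_zero_of_sum_eq_one hq.isStarProjection hq.sum_eq_one hij
  obtain ⟨f, hf⟩ := exists_coloring_sum_le hn k
    (fun i j => (τ (q i * star x * q j * x)).re) fun i => by
      have h : τ (q i * star x * q i * x) = τ (star (q i * x * q i) * (q i * x * q i)) := by
        rw [star_mul, star_mul, hs]
        calc τ (q i * star x * q i * x) = τ ((q i * q i) * star x * (q i * q i) * x) := by rw [hi]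
          _ = τ (q i * (q i * star x * q i * (q i * x))) := by simp only [mul_assoc]
          _ = τ ((q i * star x * q i * (q i * x)) * q i) := hτ.tracial _ _
          _ = _ := by simp only [mul_assoc]
      rw [h]
      exact hτ.nonneg_re _
  let p : Fin n → N := fun c => ∑ i, if f i = c then q i else 0
  have hp : IsPartition B p :=
    { isStarProjection := fun c => by
        constructor
        · change p c * p c = p c
          rw [Finset.sum_mul_sum]
          refine Finset.sum_congr rfl fun i _ => ?_
          rw [Finset.sum_eq_single i]
          · split_ifs <;> simp [hi]
          · intro j _ hj
            split_ifs <;> simp [ho i j hj.symm]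
          · simp
        · change star (p c) = p c
          rw [star_sum]
          refine Finset.sum_congr rfl fun i _ => ?_
          split_ifs <;> simp [hs]
      mem := fun c => sum_mem fun i _ => by
        split_ifs
        · exact hq.mem i
        · exact zero_mem B
      sum_eq_one := by
        rw [Finset.sum_comm]
        simpa using hq.sum_eq_one }
  refine ⟨p, hp, ?_⟩
  have h1 : l2Norm τ (∑ i, p i * x * p i) ^ 2
      = ∑ i, ∑ j, if f i = f j then (τ (q i * star x * q j * x)).re else 0 := by
    rw [hτ.l2Norm_sq_sum hp.isStarProjection fun i j hij =>
      hτ.mul_eq_zero_of_sum_eq_one hp.isStarProjection hp.sum_eq_one hij]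
    have h2 : ∀ c, (τ (p c * star x * p c * x)).re = ∑ i, ∑ j,
        if f i = c ∧ f j = c then (τ (q i * star x * q j * x)).re else 0 := fun c => by
      simp only [p]
      rw [Finset.sum_mul, Finset.sum_mul_sum, Finset.sum_mul, map_sum, Complex.re_sum]
      refine Finset.sum_congr rfl fun i _ => ?_
      rw [Finset.sum_mul, map_sum, Complex.re_sum]
      refine Finset.sum_congr rfl fun j _ => ?_
      by_cases h1 : f i = c <;> by_cases h2 : f j = c <;> simp [h1, h2]
    simp_rw [h2]
    rw [Finset.sum_comm]
    refine Finset.sum_congr rfl fun i _ => ?_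
    rw [Finset.sum_comm]
    refine Finset.sum_congr rfl fun j _ => ?_
    rw [Finset.sum_eq_single (f i)]
    · simp [eq_comm]
    · intro c _ hc
      rw [if_neg fun h => hc h.1.symm]
    · simp
  have h3 : l2Norm τ x ^ 2 = ∑ i, ∑ j, (τ (q i * star x * q j * x)).re := by
    rw [hτ.l2Norm_sq]
    have : star x * x = ∑ i, ∑ j, q i * star x * q j * x := by
      simp_rw [← Finset.sum_mul, ← Finset.mul_sum, hq.sum_eq_one, mul_one, ← Finset.sum_mul,
        hq.sum_eq_one, one_mul]
    rw [this, map_sum, Complex.re_sum]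
    refine Finset.sum_congr rfl fun i _ => ?_
    rw [map_sum, Complex.re_sum]
  rw [h1, h3, hτ.l2Norm_sq_sum hq.isStarProjection ho]
  exact hf

end Pinching

/-! ### Maximal partial isometries and comparison of projections in a factor. -/

section PartialIsometry

variable {N : Type*} [CStarAlgebra N] {τ : N →ₗ[ℂ] ℂ} {B : StarSubalgebra ℂ N}

theorem norm_le_one_of_mul_star_mul {v : N} (hv : v * star v * v = v) : ‖v‖ ≤ 1 := by
  have h : IsStarProjection (star v * v) :=
    ⟨by rw [IsIdempotentElem, ← mul_assoc, mul_assoc (star v), mul_assoc (star v), hv],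
      .star_mul_self v⟩
  have h1 := h.norm_le
  rw [CStarRing.norm_star_mul_self] at h1
  nlinarith [norm_nonneg v]

/-- The extension order on partial isometries: `w` extends `v`. -/
def Extends (v w : N) : Prop :=
  w * star v = v * star v ∧ star v * w = star v * v

theorem Extends.refl (v : N) : Extends v v := ⟨rfl, rfl⟩

theorem Extends.trans {u v w : N} (hu : u * star u * u = u) (huv : Extends u v)
    (hvw : Extends v w) : Extends u w := by
  have h1 := congrArg star huv.1
  have h2 := congrArg star huv.2
  have hu' := congrArg star hu
  simp only [star_mul, star_star] at h1 h2 hu'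
  constructor
  · have e : star u = star v * (u * star u) := by
      rw [← mul_assoc, h2, mul_assoc]; exact hu'.symm
    calc w * star u = (w * star v) * (u * star u) := by rw [mul_assoc, ← e]
      _ = v * (star v * (u * star u)) := by rw [hvw.1, mul_assoc]
      _ = _ := by rw [← e, huv.1]
  · have e : star u = star u * u * star v := by
      rw [mul_assoc, h1, ]; exact hu'.symm
    calc star u * w = star u * u * (star v * w) := by rw [← mul_assoc, ← e]
      _ = star u * u * star v * v := by rw [hvw.2, mul_assoc]; simp only [mul_assoc]
      _ = _ := by rw [← e, huv.2]

/-- A set of partial isometries that is closed under weak limits has maximal elements. -/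
theorem HasWeakLimits.exists_maximal (hW : HasWeakLimits τ B) (hτ : IsFaithfulTracialState τ)
    {C : Set N} (hne : C.Nonempty) (hCB : C ⊆ B) (hC : ∀ v ∈ C, v * star v * v = v)
    (hlim : ∀ (U : Ultrafilter C) (y : N), y ∈ B → WeakTendsto τ (fun v : C => (v : N)) U y →
      (∀ᶠ v : C in (U : Filter C), y * star (v : N) = v * star (v : N)) →
      y * star y * y = y → y ∈ C) :
    ∃ v ∈ C, ∀ w ∈ C, Extends v w → Extends w v := by
  let _ : Preorder C :=
    { le := fun v w => Extends (v : N) w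
      le_refl := fun v => .refl _
      le_trans := fun u v w huv hvw => huv.trans (hC _ u.2) hvw }
  have hchain : ∀ c : Set C, IsChain (· ≤ ·) c → BddAbove c := by
    intro c hc
    rcases c.eq_empty_or_nonempty with rfl | hcne
    · obtain ⟨v, hv⟩ := hne
      exact ⟨⟨v, hv⟩, by simp⟩
    have : Nonempty c := hcne.to_subtype
    have hdir : IsDirectedOrder c := ⟨directedOn_iff_directed.mp hc.directedOn⟩
    -- The bound of the chain is a weak limit along an ultrafilter containing all its tails. The
    -- extension identities with a given v hold on a tail, so they pass to the limit.
    let U : Ultrafilter c := Ultrafilter.of atTop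
    have hU : ∀ v : c, ∀ᶠ w in (U : Filter c), v ≤ w := fun v =>
      (Ultrafilter.of_le atTop) (eventually_ge_atTop v)
    obtain ⟨y, hyB, -, hy⟩ := hW.exists_weakTendsto U (f := fun v : c => ((v : C) : N)) (C := 1)
      (Eventually.of_forall fun v => ⟨hCB (v : C).2, norm_le_one_of_mul_star_mul (hC _ (v : C).2)⟩)
    have h1 : ∀ v : c, y * star ((v : C) : N) = ((v : C) : N) * star ((v : C) : N) := fun v =>
      (hy.mul_const _).unique hτ ((weakTendsto_const _).congr'
        ((hU v).mono fun w hw => (show Extends ((v : C) : N) ((w : C) : N) from hw).1.symm))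
    have h2 : ∀ v : c, star ((v : C) : N) * y = star ((v : C) : N) * ((v : C) : N) := fun v =>
      (hy.const_mul hτ _).unique hτ ((weakTendsto_const _).congr'
        ((hU v).mono fun w hw => (show Extends ((v : C) : N) ((w : C) : N) from hw).2.symm))
    -- The approximants y v* y equal v v* v = v, which tends to y.
    have h3 : y * star y * y = y := by
      refine (((hy.star hτ).const_mul hτ y).mul_const y).unique hτ (hy.congr' ?_)
      refine Eventually.of_forall fun v => ?_
      change ((v : C) : N) = _
      beta_reduce
      rw [h1, mul_assoc, h2, ← mul_assoc, hC _ (v : C).2]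
    have hyC : y ∈ C := hlim (U.map fun v => (v : C)) y hyB (fun b => hy b)
      (Eventually.of_forall (f := (U : Filter c)) h1) h3
    exact ⟨⟨y, hyC⟩, fun v hv => ⟨h1 ⟨v, hv⟩, h2 ⟨v, hv⟩⟩⟩
  obtain ⟨m, hm⟩ := zorn_le hchain
  exact ⟨m, m.2, fun w hw h => hm (b := ⟨w, hw⟩) h⟩

theorem cfc_id_mul {b : N} (hb : IsSelfAdjoint b) {g : ℝ → ℝ} (hg : Continuous g) :
    cfc (fun s => s * g s) b = b * cfc g b := by
  rw [cfc_mul (fun s : ℝ => s) g b continuous_id.continuousOn hg.continuousOn, cfc_id' ℝ b]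

theorem cfc_mul_mul_mul_cfc {b : N} (hb : IsSelfAdjoint b) {φ k : ℝ → ℝ} (hφ : Continuous φ)
    (hk : Continuous k) (h : ∀ s, φ s * s * φ s * k s = k s) :
    cfc φ b * b * cfc φ b * cfc k b = cfc k b := by
  have hid : Continuous fun s : ℝ => s := continuous_id
  calc cfc φ b * b * cfc φ b * cfc k b
      = cfc φ b * cfc (fun s : ℝ => s) b * cfc φ b * cfc k b := by rw [cfc_id' ℝ b]
    _ = cfc (fun s => φ s * s * φ s * k s) b := by
      rw [← cfc_mul φ _ b hφ.continuousOn hid.continuousOn,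
        ← cfc_mul (fun s => φ s * s) φ b (hφ.mul hid).continuousOn hφ.continuousOn,
        ← cfc_mul (fun s => φ s * s * φ s) k b ((hφ.mul hid).mul hφ).continuousOn
          hk.continuousOn]
    _ = cfc k b := by simp_rw [h]

/-- A partial isometry from the polar decomposition of `y`. -/
theorem exists_partialIsometry_of_ne_zero (hR : HasRangeProjections (⊤ : StarSubalgebra ℂ N))
    {y : N} (hy : y ≠ 0) : ∃ w : N, w ≠ 0 ∧ w * star w * w = w ∧ (∀ f, f * y = y → f * w = w) ∧
      ∀ e, IsSelfAdjoint e → y * e = y → w * e = w := by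
  let _ := CStarAlgebra.spectralOrder N
  have _ := CStarAlgebra.spectralOrderedRing N
  have hnt : Nontrivial N := ⟨y, 0, hy⟩
  set b := star y * y with hb
  have hb0 : 0 ≤ b := star_mul_self_nonneg y
  have hbsa : IsSelfAdjoint b := .star_mul_self y
  -- Cutting the spectrum of b = y*y at half its top avoids an unbounded inverse: φ(s) is s^(-1/2)
  -- above t, and k lives only there. With q the range projection of k(b), the element y φ(b) q has
  -- q as initial projection.
  set t := ‖b‖ / 2 with ht
  have ht0 : 0 < t := by
    rw [ht, hb, CStarRing.norm_star_mul_self]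
    have := norm_pos_iff.mpr hy
    positivity
  have hm : ∀ s : ℝ, 0 < max s t := fun s => lt_max_of_lt_right ht0
  let φ : ℝ → ℝ := fun s => (√(max s t))⁻¹
  let k : ℝ → ℝ := fun s => max (s - t) 0
  let g : ℝ → ℝ := fun s => max (s - t) 0 / max s t
  have hφc : Continuous φ :=
    Continuous.inv₀ (by fun_prop) fun s => (Real.sqrt_pos.mpr (hm s)).ne'
  have hkc : Continuous k := by fun_prop
  have hgc : Continuous g := Continuous.div (by fun_prop) (by fun_prop) fun s => (hm s).ne'
  set h := cfc k b with hh
  set c := cfc φ b with hc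
  have hcs : star c = c := (cfc_predicate φ b : IsSelfAdjoint _).star_eq
  have h1 : h = b * cfc g b := by
    rw [hh, ← cfc_id_mul hbsa hgc]
    refine cfc_congr fun s _ => ?_
    simp only [k, g]
    rcases le_total s t with hs | hs
    · rw [max_eq_right (by linarith : s - t ≤ 0)]; simp
    · rw [max_eq_left hs]
      have : s ≠ 0 := by linarith
      field_simp
  have h2 : c * b * c * h = h := by
    refine cfc_mul_mul_mul_cfc hbsa hφc hkc fun s => ?_
    simp only [k, φ]
    rcases le_total s t with hs | hs
    · rw [max_eq_right (by linarith : s - t ≤ 0), mul_zero]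
    · rw [max_eq_left hs]
      have hs0 : 0 < s := by linarith
      have h3 : √s ^ 2 = s := Real.sq_sqrt hs0.le
      have h4 : √s ≠ 0 := (Real.sqrt_pos.mpr hs0).ne'
      have h5 : (√s)⁻¹ * s * (√s)⁻¹ = 1 := by
        field_simp
        exact h3.symm
      rw [h5, one_mul]
  obtain ⟨q, -, hq, hqh, hz⟩ := hR h trivial
  have hqs : star q = q := hq.2
  have hqi : q * q = q := hq.1
  have h3 : c * b * c * q = q := by
    have := hz (c * b * c - 1) (by rw [sub_mul, h2, one_mul, sub_self])
    rwa [sub_mul, one_mul, sub_eq_zero] at this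
  have h4 : star (y * c * q) * (y * c * q) = q := by
    calc star (y * c * q) * (y * c * q) = q * (c * b * c * q) := by
          simp only [star_mul, hqs, hcs, hb, mul_assoc]
      _ = q := by rw [h3, hqi]
  refine ⟨y * c * q, ?_, ?_, ?_, ?_⟩
  · intro h0
    rw [h0, mul_zero] at h4
    rw [← h4, zero_mul] at hqh
    -- The value ‖b‖ is in the spectrum of b and k takes the value t > 0 there, so k(b) ≠ 0.
    have h5 := norm_apply_le_norm_cfc k b (CStarAlgebra.norm_mem_spectrum_of_nonneg hb0)
    rw [← hh, ← hqh, norm_zero] at h5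
    have h6 : k ‖b‖ = t := by
      simp only [k]
      rw [max_eq_left] <;> linarith
    rw [h6, Real.norm_eq_abs, abs_of_pos ht0] at h5
    linarith
  · rw [mul_assoc, h4, mul_assoc, hqi]
  · intro f hf
    rw [← mul_assoc, ← mul_assoc, hf]
  · intro e he hye
    have heb : e * b = b := by
      have := congrArg star hye
      rw [star_mul, he.star_eq] at this
      rw [hb, ← mul_assoc, this]
    have h5 := hz (e - 1) (by rw [sub_mul, one_mul, h1, ← mul_assoc, heb, sub_self])
    rw [sub_mul, one_mul, sub_eq_zero] at h5
    have h6 := congrArg star h5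
    rw [star_mul, hqs, he.star_eq] at h6
    rw [mul_assoc, h6]

theorem IsFaithfulTracialState.eq_zero_of_re (hτ : IsFaithfulTracialState τ) {q : N}
    (hq : IsStarProjection q) (h : (τ q).re = 0) : q = 0 := by
  have h1 : star q * q = q := by rw [hq.2.star_eq]; exact hq.1
  have h2 := hτ.nonneg_im q
  refine hτ.faithful q ?_
  rw [h1] at h2 ⊢
  exact Complex.ext h h2

theorem IsFaithfulTracialState.re_nonneg (hτ : IsFaithfulTracialState τ) {q : N}
    (hq : IsStarProjection q) : 0 ≤ (τ q).re := by
  have h1 : star q * q = q := by rw [hq.2.star_eq]; exact hq.1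
  have h2 := hτ.nonneg_re q
  rwa [h1] at h2

/-- In a factor, projections with equal traces are equivalent. -/
theorem HasWeakLimits.exists_partialIsometry (hW : HasWeakLimits τ (⊤ : StarSubalgebra ℂ N))
    (hτ : IsFaithfulTracialState τ) (hR : HasRangeProjections (⊤ : StarSubalgebra ℂ N))
    (hF : ∀ z e : N, (∀ y, z * y * e = 0) → z = 0 ∨ e = 0) {e f : N} (he : IsStarProjection e)
    (hf : IsStarProjection f) (hef : (τ e).re = (τ f).re) :
    ∃ v : N, star v * v = e ∧ v * star v = f := by
  have hei : e * e = e := he.1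
  have hfi : f * f = f := hf.1
  have hes : star e = e := he.2
  have hfs : star f = f := hf.2
  obtain ⟨v, ⟨hv, hfv, hve⟩, hmax⟩ := hW.exists_maximal hτ
    (C := {v | v * star v * v = v ∧ f * v = v ∧ v * e = v}) ⟨0, by simp⟩ (fun _ _ => trivial)
    (fun v hv => hv.1) (fun U y _ hy _ h =>
      ⟨h, (hy.const_mul hτ f).unique hτ (hy.congr' (Eventually.of_forall fun v => v.2.2.1.symm)),
        (hy.mul_const e).unique hτ (hy.congr' (Eventually.of_forall fun v => v.2.2.2.symm))⟩)
  have hev : e * star v = star v := by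
    have := congrArg star hve
    rwa [star_mul, hes] at this
  have hvf : star v * f = star v := by
    have := congrArg star hfv
    rwa [star_mul, hfs] at this
  have hv' : star v * v * star v = star v := by
    have := congrArg star hv
    rw [star_mul, star_mul, star_star] at this
    rw [mul_assoc]; exact this
  have hp : IsStarProjection (star v * v) :=
    ⟨by rw [IsIdempotentElem, ← mul_assoc, hv'], .star_mul_self v⟩
  have hp' : IsStarProjection (v * star v) :=
    ⟨by rw [IsIdempotentElem, ← mul_assoc, hv], .mul_star_self v⟩
  have he' : IsStarProjection (e - star v * v) :=
    hp.sub_of_mul_eq_left he (by rw [mul_assoc, hve])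
  have hf' : IsStarProjection (f - v * star v) :=
    hp'.sub_of_mul_eq_left hf (by rw [mul_assoc, hvf])
  have htr : (τ (e - star v * v)).re = (τ (f - v * star v)).re := by
    rw [map_sub, map_sub, Complex.sub_re, Complex.sub_re, hef, hτ.tracial (star v)]
  have hzero : e - star v * v = 0 := by
    by_contra he0
    have hf0 : f - v * star v ≠ 0 := fun h => he0 (hτ.eq_zero_of_re he' (by
      rw [htr, h, map_zero, Complex.zero_re]))
    -- Both remainders are non-zero since they have the same trace. Factoriality links them, and a
    -- partial isometry w between them makes v + w a proper extension of the maximal v.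
    obtain ⟨y, hy⟩ : ∃ y, (f - v * star v) * y * (e - star v * v) ≠ 0 := by
      by_contra! h
      rcases hF _ _ h with h | h
      · exact hf0 h
      · exact he0 h
    obtain ⟨w, hw0, hw, hwl, hwr⟩ := exists_partialIsometry_of_ne_zero hR hy
    have hfw := hwl (f - v * star v) (by rw [← mul_assoc, ← mul_assoc, hf'.1])
    have hwe := hwr (e - star v * v) he'.2 (by rw [mul_assoc, he'.1])
    have hwv : w * star v = 0 := by
      rw [← hwe, mul_assoc, sub_mul, hev, hv', sub_self, mul_zero]
    have hvw : star v * w = 0 := by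
      rw [← hfw, ← mul_assoc, mul_sub, hvf, ← mul_assoc, hv', sub_self, zero_mul]
    have hwv' : v * star w = 0 := by
      have := congrArg star hwv
      rwa [star_mul, star_star, star_zero] at this
    have hvw' : star w * v = 0 := by
      have := congrArg star hvw
      rwa [star_mul, star_star, star_zero] at this
    have hfw' : f * w = w := by
      rw [← hfw, ← mul_assoc, mul_sub, hfi, ← mul_assoc, hfv]
    have hwe' : w * e = w := by
      rw [← hwe, mul_assoc, sub_mul, hei, mul_assoc, hve]
    have h := hmax (v + w) ⟨?_, by rw [mul_add, hfv, hfw'], by rw [add_mul, hve, hwe']⟩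
      ⟨by rw [add_mul, hwv, add_zero], by rw [mul_add, hvw, add_zero]⟩
    · have h1 := h.1
      simp only [star_add, mul_add, add_mul, hwv', hwv, add_zero, zero_add, left_eq_add] at h1
      exact hw0 (by rw [← hw, h1, zero_mul])
    · simp only [star_add, mul_add, add_mul, hwv', hwv, add_zero, zero_add, hv, hw]
      rw [mul_assoc w, hvw', mul_assoc v, hvw, mul_zero, mul_zero, add_zero, zero_add]
  refine ⟨v, (sub_eq_zero.mp hzero).symm, ?_⟩
  rw [hzero, map_zero, Complex.zero_re] at htr
  exact (sub_eq_zero.mp (hτ.eq_zero_of_re hf' htr.symm)).symm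

end PartialIsometry

/-! ### Projections of prescribed trace in a diffuse algebra. -/

section Diffuse

variable {N : Type*} [CStarAlgebra N] {τ : N →ₗ[ℂ] ℂ} {B : StarSubalgebra ℂ N}

/-- Every non-zero projection of `B` strictly dominates a non-zero projection of `B`. -/
def HasNoMinimalProjections (B : StarSubalgebra ℂ N) : Prop :=
  ∀ p ∈ B, IsStarProjection p → p ≠ 0 →
    ∃ q ∈ B, IsStarProjection q ∧ q ≠ 0 ∧ q ≠ p ∧ p * q = q

/-- When r is split as q + (r - q), one of the two parts carries at most half of the trace. -/
theorem HasNoMinimalProjections.exists_re_le (hD : HasNoMinimalProjections B) {p : N}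
    (hpB : p ∈ B) (hp : IsStarProjection p) (hp0 : p ≠ 0)
    (k : ℕ) : ∃ r ∈ B, IsStarProjection r ∧ r ≠ 0 ∧ p * r = r ∧
      (τ r).re ≤ (τ p).re * (1 / 2) ^ k := by
  induction k with
  | zero => exact ⟨p, hpB, hp, hp0, hp.1, by simp⟩
  | succ k ih =>
    obtain ⟨r, hrB, hr, hr0, hpr, hrk⟩ := ih
    obtain ⟨q, hqB, hq, hq0, hqr, hrq⟩ := hD r hrB hr hr0
    have hpq : p * q = q := by rw [← hrq, ← mul_assoc, hpr]
    have hsum : (τ q).re + (τ (r - q)).re = (τ r).re := by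
      rw [map_sub, Complex.sub_re]; ring
    rw [pow_succ]
    rcases le_total (τ q).re (τ (r - q)).re with h | h
    · exact ⟨q, hqB, hq, hq0, hpq, by linarith⟩
    · exact ⟨r - q, sub_mem hrB hqB, hq.sub_of_mul_eq_right hr hrq,
        fun h0 => hqr (sub_eq_zero.mp h0).symm, by rw [mul_sub, hpr, hpq], by linarith⟩

/-- A diffuse subalgebra has projections of every possible trace. -/
theorem HasNoMinimalProjections.exists_re_eq (hD : HasNoMinimalProjections B)
    (hW : HasWeakLimits τ B) (hτ : IsFaithfulTracialState τ) {p : N} (hpB : p ∈ B)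
    (hp : IsStarProjection p) {t : ℝ} (ht0 : 0 ≤ t) (ht : t ≤ (τ p).re) :
    ∃ q ∈ B, IsStarProjection q ∧ p * q = q ∧ (τ q).re = t := by
  have hpi : ∀ {v : N}, IsStarProjection v → v * star v * v = v := fun hv => by
    rw [hv.2.star_eq, hv.1, hv.1]
  obtain ⟨q, ⟨hqB, hq, hpq, hqt⟩, hmax⟩ := hW.exists_maximal hτ
    (C := {q | q ∈ B ∧ IsStarProjection q ∧ p * q = q ∧ (τ q).re ≤ t})
    ⟨0, zero_mem B, .zero N, by simp, by simpa using ht0⟩ (fun v hv => hv.1)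
    (fun v hv => hpi hv.2.1) (fun U y hyB hy hyv h => by
      have hsa : star y = y := (hy.star hτ).unique hτ
        (hy.congr' (Eventually.of_forall fun v => v.2.2.1.2.star_eq.symm))
      refine ⟨hyB, ⟨(hy.const_mul hτ y).unique hτ (hy.congr' ?_), hsa⟩,
        (hy.const_mul hτ p).unique hτ
          (hy.congr' (Eventually.of_forall fun v => v.2.2.2.1.symm)), ?_⟩
      · filter_upwards [hyv] with v hv
        rw [v.2.2.1.2.star_eq, v.2.2.1.1] at hv
        exact hv.symm
      · exact le_of_tendsto' ((Complex.continuous_re.tendsto _).comp hy.tendsto)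
          fun v => v.2.2.2.2)
  refine ⟨q, hqB, hq, hpq, hqt.antisymm (not_lt.mp fun hlt => ?_)⟩
  have hpqB : p - q ∈ B := sub_mem hpB hqB
  have hpqp : IsStarProjection (p - q) := hq.sub_of_mul_eq_right hp hpq
  have hpq0 : p - q ≠ 0 := fun h => by
    rw [sub_eq_zero.mp h] at ht
    exact absurd ht (not_le.mpr hlt)
  -- If the maximal q had trace below t, a small enough non-zero projection under p - q could be
  -- added to it.
  have hlim : Tendsto (fun k : ℕ => (τ (p - q)).re * (1 / 2) ^ k) atTop (𝓝 0) := by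
    simpa using (tendsto_pow_atTop_nhds_zero_of_lt_one (r := (1 / 2 : ℝ)) (by norm_num)
      (by norm_num)).const_mul (τ (p - q)).re
  obtain ⟨k, hk⟩ := (hlim.eventually_lt_const (sub_pos.mpr hlt)).exists
  obtain ⟨r, hrB, hr, hr0, hpr, hrk⟩ := hD.exists_re_le (τ := τ) hpqB hpqp hpq0 k
  have hqp : q * p = q := by
    have := congrArg star hpq
    rwa [star_mul, hq.2.star_eq, hp.2.star_eq] at this
  have hqr : q * r = 0 := by
    rw [← hpr, ← mul_assoc, mul_sub, hqp, hq.1, sub_self, zero_mul]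
  have hrq : r * q = 0 := by
    have := congrArg star hqr
    rwa [star_mul, hq.2.star_eq, hr.2.star_eq, star_zero] at this
  have hprr : p * r = r := by
    rw [← hpr, ← mul_assoc, mul_sub, hp.1, hpq]
  have hqr' : IsStarProjection (q + r) := hq.add hr hqr
  have h := hmax (q + r) ⟨add_mem hqB hrB, hqr', by rw [mul_add, hpq, hprr], by
      rw [map_add, Complex.add_re]; linarith⟩
    ⟨by rw [hq.2.star_eq, add_mul, hrq, add_zero], by rw [hq.2.star_eq, mul_add, hqr, add_zero]⟩
  have h1 := h.1
  rw [hqr'.2.star_eq, hqr'.1, mul_add, hq.1, hqr, add_zero, left_eq_add] at h1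
  exact hr0 h1

theorem HasNoMinimalProjections.exists_partition (hD : HasNoMinimalProjections B)
    (hW : HasWeakLimits τ B) (hτ : IsFaithfulTracialState τ) {s : ℝ} (hs : 0 ≤ s) (m : ℕ) :
    ∀ p ∈ B, IsStarProjection p → (τ p).re = m * s → ∃ e : Fin m → N,
      (∀ i, e i ∈ B ∧ IsStarProjection (e i) ∧ (τ (e i)).re = s) ∧ ∑ i, e i = p := by
  induction m with
  | zero =>
    intro p hpB hp h
    refine ⟨fun i => i.elim0, fun i => i.elim0, ?_⟩
    rw [hτ.eq_zero_of_re hp (by simpa using h)]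
    simp
  | succ m ih =>
    intro p hpB hp h
    push_cast at h
    have hms : 0 ≤ m * s := by positivity
    obtain ⟨q, hqB, hq, hpq, hqs⟩ := hD.exists_re_eq hW hτ hpB hp hs (by linarith)
    obtain ⟨e, he, hsum⟩ := ih (p - q) (sub_mem hpB hqB) (hq.sub_of_mul_eq_right hp hpq)
      (by rw [map_sub, Complex.sub_re]; linarith)
    refine ⟨Fin.cons q e, fun i => ?_, by rw [Fin.sum_univ_succ]; simp [hsum]⟩
    refine Fin.cases ?_ (fun i => ?_) i
    · exact ⟨hqB, hq, hqs⟩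
    · exact he i

end Diffuse

/-! ### Flat hermitian unitary matrices. -/

section Conference

open Matrix

/-- Skew-symmetric conference matrices of order `2 ^ k`. -/
theorem exists_skew_conference_matrix (k : ℕ) :
    ∃ (ι : Type) (_ : Fintype ι) (_ : DecidableEq ι) (S : Matrix ι ι ℝ),
      Fintype.card ι = 2 ^ k ∧ Sᵀ = -S ∧ S * S = -((2 ^ k - 1 : ℝ) • (1 : Matrix ι ι ℝ)) ∧
        ∀ i j, i ≠ j → S i j ^ 2 = 1 := by
  induction k with
  | zero =>
    exact ⟨Unit, inferInstance, inferInstance, 0, by simp, by simp, by simp,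
      fun i j h => absurd (Subsingleton.elim i j) h⟩
  | succ k ih =>
    obtain ⟨ι, _, _, S, hcard, hS, hS2, hS1⟩ := ih
    have hdiag : ∀ i, S i i = 0 := fun i => by
      have := congrFun (congrFun hS i) i
      rw [transpose_apply, Matrix.neg_apply] at this
      linarith
    -- Doubling: the diagonal blocks of the square are 2S² - 1 = -(2^(k+1) - 1), the off-diagonal
    -- ones cancel, and ±1 fills the zero diagonals of the off-diagonal blocks.
    refine ⟨ι ⊕ ι, inferInstance, inferInstance, fromBlocks S (S + 1) (S - 1) (-S), ?_, ?_, ?_, ?_⟩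
    · rw [Fintype.card_sum, hcard]; ring
    · rw [fromBlocks_transpose, fromBlocks_neg, transpose_neg, transpose_add, transpose_sub,
        transpose_one, hS]
      congr 1 <;> abel
    · have hone : (1 : Matrix (ι ⊕ ι) (ι ⊕ ι) ℝ) = fromBlocks 1 0 0 1 := fromBlocks_one.symm
      rw [fromBlocks_multiply, hone, fromBlocks_smul, fromBlocks_neg]
      congr 1
      · rw [add_mul, mul_sub, mul_one, one_mul, hS2, pow_succ]
        module
      · rw [mul_add, mul_neg, add_mul, one_mul, mul_one, smul_zero, neg_zero]
        abel
      · rw [sub_mul, neg_mul, mul_sub, one_mul, mul_one, smul_zero, neg_zero]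
        abel
      · rw [neg_mul_neg, sub_mul, mul_add, one_mul, mul_one, hS2, pow_succ]
        module
    · rintro (i | i) (j | j) hij
      · exact hS1 i j fun h => hij (by rw [h])
      · rw [fromBlocks_apply₁₂, Matrix.add_apply, one_apply]
        split_ifs with h
        · rw [h, hdiag]; norm_num
        · rw [add_zero, hS1 i j h]
      · rw [fromBlocks_apply₂₁, Matrix.sub_apply, one_apply]
        split_ifs with h
        · rw [h, hdiag]; norm_num
        · rw [sub_zero, hS1 i j h]
      · rw [fromBlocks_apply₂₂, Matrix.neg_apply, neg_sq]
        exact hS1 i j fun h => hij (by rw [h])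

/-- Hermitian unitary matrices with zero diagonal and otherwise flat entries. -/
theorem exists_flat_hermitian_unitary {k : ℕ} (hk : k ≠ 0) :
    ∃ (ι : Type) (_ : Fintype ι) (_ : DecidableEq ι) (c : Matrix ι ι ℂ),
      Fintype.card ι = 2 ^ k ∧ (∀ i j, star (c j i) = c i j) ∧ c * c = 1 ∧
        ∀ i j, c i j * c j i = if i = j then 0 else (((2 ^ k - 1 : ℝ)⁻¹ : ℝ) : ℂ) := by
  obtain ⟨ι, _, _, S, hcard, hS, hS2, hS1⟩ := exists_skew_conference_matrix k
  have hpos : (0 : ℝ) < 2 ^ k - 1 := by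
    have := one_lt_pow₀ (one_lt_two (α := ℝ)) hk
    linarith
  set d : ℝ := 2 ^ k - 1 with hd
  have hskew : ∀ i j, S j i = -S i j := fun i j => congrFun (congrFun hS i) j
  have hdd : ((√d : ℝ) : ℂ) * ((√d : ℝ) : ℂ) = (d : ℂ) := by
    rw [← Complex.ofReal_mul, Real.mul_self_sqrt hpos.le]
  have hd0 : (d : ℂ) ≠ 0 := by exact_mod_cast hpos.ne'
  have hs0 : ((√d : ℝ) : ℂ) ≠ 0 := by exact_mod_cast (Real.sqrt_pos.mpr hpos).ne'
  -- The factor i makes the real skew matrix hermitian, and 1/√d makes it unitary because S² = -d.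
  let z : ℂ := Complex.I * ((√d : ℝ) : ℂ)⁻¹
  have hz : z * z = -(d : ℂ)⁻¹ := by
    simp only [z]
    rw [mul_mul_mul_comm, Complex.I_mul_I, ← mul_inv, hdd, neg_one_mul]
  refine ⟨ι, inferInstance, inferInstance, z • S.map (fun r => (r : ℂ)), hcard, ?_, ?_, ?_⟩
  · intro i j
    simp [z, hskew i j]
  · have h1 : (S.map (fun r => (r : ℂ))) * (S.map (fun r => (r : ℂ)))
        = (S * S).map (fun r => (r : ℂ)) := by
      ext i j
      simp [Matrix.mul_apply]
    rw [smul_mul_smul_comm, hz, h1, hS2]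
    ext i j
    simp only [Matrix.smul_apply, Matrix.map_apply, Matrix.neg_apply, Matrix.one_apply, smul_eq_mul]
    split_ifs <;> simp [hd0]
  · intro i j
    have h2 : (z • S.map (fun r => (r : ℂ))) i j * (z • S.map (fun r => (r : ℂ))) j i
        = (d : ℂ)⁻¹ * ((S i j ^ 2 : ℝ) : ℂ) := by
      simp only [Matrix.smul_apply, Matrix.map_apply, smul_eq_mul, hskew i j]
      rw [mul_mul_mul_comm, hz]
      push_cast
      ring
    rw [h2]
    split_ifs with h
    · subst h
      have : S i i = 0 := by linarith [hskew i i]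
      rw [this]; simp
    · rw [hS1 i j h]; simp

end Conference

/-! ### Matrix units v i * star (v j) with complex coefficients. -/

section MatrixUnits

set_option linter.unusedSectionVars false

variable {N : Type*} [Ring N] [StarRing N] [Algebra ℂ N] [StarModule ℂ N] {τ : N →ₗ[ℂ] ℂ}
  {ι : Type*} [Fintype ι] [DecidableEq ι] {v : ι → N} {r : N} {c : Matrix ι ι ℂ}

theorem isSelfAdjoint_sum_smul (hc : ∀ i j, star (c j i) = c i j) :
    IsSelfAdjoint (∑ i, ∑ j, c i j • (v i * star (v j))) := by
  rw [IsSelfAdjoint, star_sum, Finset.sum_comm]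
  simp_rw [star_sum, star_smul, star_mul, star_star]
  rw [Finset.sum_comm]
  conv_rhs => rw [Finset.sum_comm]
  simp_rw [hc]

theorem sum_smul_mul_self (hv : ∀ i j, star (v i) * v j = if i = j then r else 0)
    (hvr : ∀ i, v i * r = v i) (h1 : ∑ i, v i * star (v i) = 1) (hc : c * c = 1) :
    (∑ i, ∑ j, c i j • (v i * star (v j))) * (∑ i, ∑ j, c i j • (v i * star (v j))) = 1 := by
  have h2 : ∀ i j k l, v i * star (v j) * (v k * star (v l))
      = if j = k then v i * star (v l) else 0 := fun i j k l => by
    rw [mul_assoc, ← mul_assoc (star (v j)), hv]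
    split_ifs
    · rw [← mul_assoc, hvr]
    · simp
  calc _ = ∑ i, ∑ j, ∑ l, (c i j * c j l) • (v i * star (v l)) := by
        rw [Finset.sum_mul]
        refine Finset.sum_congr rfl fun i _ => ?_
        rw [Finset.sum_mul]
        refine Finset.sum_congr rfl fun j _ => ?_
        rw [Finset.mul_sum, Finset.sum_eq_single j]
        · rw [Finset.mul_sum]
          simp [h2, smul_smul, mul_comm]
        · intro k _ hk
          rw [Finset.mul_sum]
          simp [h2, hk.symm]
        · simp
    _ = ∑ i, ∑ l, (c * c) i l • (v i * star (v l)) := by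
        refine Finset.sum_congr rfl fun i _ => ?_
        rw [Finset.sum_comm]
        simp_rw [Matrix.mul_apply, Finset.sum_smul]
    _ = 1 := by
        rw [hc, ← h1]
        simp [Matrix.one_apply, ite_smul]

/-- Only off-diagonal matrix units occur, and their product with an element commuting with the
diagonal ones has trace zero. -/
theorem IsFaithfulTracialState.map_sum_smul_mul (hτ : IsFaithfulTracialState τ)
    (hv : ∀ i j, star (v i) * v j = if i = j then r else 0)
    (hvr : ∀ i, v i * r = v i) (hc : ∀ i, c i i = 0) {b : N}
    (hb : ∀ i, b * (v i * star (v i)) = v i * star (v i) * b) :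
    τ ((∑ i, ∑ j, c i j • (v i * star (v j))) * b) = 0 := by
  simp_rw [Finset.sum_mul, map_sum]
  refine Finset.sum_eq_zero fun i _ => Finset.sum_eq_zero fun j _ => ?_
  by_cases hij : i = j
  · subst hij; simp [hc]
  have h1 : v i * star (v i) * v i = v i := by rw [mul_assoc, hv, if_pos rfl, hvr]
  rw [smul_mul_assoc, map_smul]
  nth_rw 1 [← h1]
  rw [mul_assoc, mul_assoc, hτ.tracial, mul_assoc, mul_assoc, hb,
    ← mul_assoc (star (v j)), ← mul_assoc (star (v j)), hv, if_neg (Ne.symm hij)]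
  simp

/-- As a commutes with the diagonal matrix units, v i* a v j = 0 for i ≠ j. Of the quadruple sum
only the products of the (i, j) and (j, i) terms survive. -/
theorem IsFaithfulTracialState.map_mul_sum_smul (hτ : IsFaithfulTracialState τ)
    (hv : ∀ i j, star (v i) * v j = if i = j then r else 0)
    (hvr : ∀ i, v i * r = v i) {a : N}
    (ha : ∀ i, a * (v i * star (v i)) = v i * star (v i) * a) :
    τ (a * (∑ i, ∑ j, c i j • (v i * star (v j))) * a * (∑ i, ∑ j, c i j • (v i * star (v j))))
      = ∑ i, ∑ j, c i j * c j i * τ (star (v i) * a * v i * (star (v j) * a * v j)) := by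
  have h0 : ∀ i j, i ≠ j → star (v i) * a * v j = 0 := fun i j hij => by
    have h1 : star (v i) * (v i * star (v i)) = star (v i) := by
      have : v i * star (v i) * v i = v i := by rw [mul_assoc, hv, if_pos rfl, hvr]
      have := congrArg star this
      simpa [mul_assoc] using this
    rw [← h1, mul_assoc _ _ a, ← ha, mul_assoc, mul_assoc, mul_assoc (v i), hv, if_neg hij]
    simp
  have h2 : ∀ i j k l, τ (a * (v i * star (v j)) * a * (v k * star (v l)))
      = τ (star (v l) * a * v i * (star (v j) * a * v k)) := fun i j k l => by
    rw [← mul_assoc _ (v k), hτ.tracial _ (star (v l))]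
    simp only [mul_assoc]
  calc _ = ∑ i, ∑ j, ∑ k, ∑ l, c i j * c k l *
        τ (star (v l) * a * v i * (star (v j) * a * v k)) := by
        have h3 : a * (∑ i, ∑ j, c i j • (v i * star (v j))) * a
            = ∑ i, ∑ j, c i j • (a * (v i * star (v j)) * a) := by
          simp only [Finset.mul_sum, Finset.sum_mul, mul_smul_comm, smul_mul_assoc]
        rw [h3]
        simp only [Finset.sum_mul_sum, map_sum, smul_mul_smul_comm, map_smul, h2, smul_eq_mul]
        exact Finset.sum_congr rfl fun i _ => Finset.sum_comm
    _ = _ := by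
        refine Finset.sum_congr rfl fun i _ => Finset.sum_congr rfl fun j _ => ?_
        rw [Finset.sum_eq_single j, Finset.sum_eq_single i]
        · intro l _ hl
          rw [h0 l i hl, zero_mul, map_zero, mul_zero]
        · simp
        · intro k _ hk
          refine Finset.sum_eq_zero fun l _ => ?_
          rw [h0 j k hk.symm, mul_zero, map_zero, mul_zero]
        · simp

end MatrixUnits

/-! ### Almost 2-independent self-adjoint unitaries. -/

section Independence

variable {N : Type*} [CStarAlgebra N] {τ : N →ₗ[ℂ] ℂ} {B : StarSubalgebra ℂ N}

/-- In a factor there are self-adjoint unitaries orthogonal to a given diffuse abelian subalgebra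
that are almost `2`-independent of it. -/
theorem HasNoMinimalProjections.exists_almost_independent (hD : HasNoMinimalProjections B)
    (hτ : IsFaithfulTracialState τ) (hW : HasWeakLimits τ (⊤ : StarSubalgebra ℂ N))
    (hWB : HasWeakLimits τ B) (hR : HasRangeProjections (⊤ : StarSubalgebra ℂ N))
    (hF : ∀ z e : N, (∀ y, z * y * e = 0) → z = 0 ∨ e = 0)
    (hc : ∀ x ∈ B, ∀ y ∈ B, x * y = y * x) {δ : ℝ} (hδ : 0 < δ) :
    ∃ x : N, IsSelfAdjoint x ∧ x * x = 1 ∧ (∀ b ∈ B, τ (x * b) = 0) ∧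
      ∀ a ∈ B, IsSelfAdjoint a →
        (τ a).re ^ 2 - δ * (τ (a * a)).re ≤ (τ (a * x * a * x)).re := by
  obtain ⟨k, hk0, hk⟩ : ∃ k : ℕ, k ≠ 0 ∧ (2 ^ k - 1 : ℝ)⁻¹ ≤ δ := by
    obtain ⟨k, hk⟩ := pow_unbounded_of_one_lt (1 + δ⁻¹) (one_lt_two (α := ℝ))
    have hδ' : 0 < δ⁻¹ := inv_pos.mpr hδ
    refine ⟨k, fun h0 => ?_, ?_⟩
    · rw [h0, pow_zero] at hk; linarith
    · exact inv_le_of_inv_le₀ hδ (by linarith)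
  obtain ⟨ι, _, _, c, hcard, hcs, hcc, hcm⟩ := exists_flat_hermitian_unitary hk0
  have hpos : (0 : ℝ) < 2 ^ k - 1 := by
    have := one_lt_pow₀ (one_lt_two (α := ℝ)) hk0
    linarith
  have h2k : (0 : ℝ) < 2 ^ k := by positivity
  obtain ⟨e', he', hsum'⟩ := hD.exists_partition hWB hτ (s := (2 ^ k : ℝ)⁻¹) (by positivity) (2 ^ k)
    1 (one_mem B) (.one N) (by rw [hτ.map_one]; push_cast; rw [mul_inv_cancel₀ h2k.ne']; rfl)
  let eqv : ι ≃ Fin (2 ^ k) := Fintype.equivFinOfCardEq hcard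
  let e : ι → N := fun i => e' (eqv i)
  have heB : ∀ i, e i ∈ B := fun i => (he' _).1
  have hep : ∀ i, IsStarProjection (e i) := fun i => (he' _).2.1
  have het : ∀ i, (τ (e i)).re = (2 ^ k : ℝ)⁻¹ := fun i => (he' _).2.2
  have hsum : ∑ i, e i = 1 := by rw [← hsum']; exact Equiv.sum_comp eqv e'
  have heo : ∀ i j, i ≠ j → e i * e j = 0 := fun i j hij =>
    hτ.mul_eq_zero_of_sum_eq_one hep hsum hij
  have hne : Nonempty ι := Fintype.card_pos_iff.mp (by rw [hcard]; positivity)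
  obtain ⟨o⟩ := hne
  set r := e o with hr
  have hv : ∀ i, ∃ v : N, star v * v = r ∧ v * star v = e i := fun i =>
    hW.exists_partialIsometry hτ hR hF (hep o) (hep i) (by rw [het, het])
  choose v hvr' hve using hv
  have hvr : ∀ i, v i * r = v i := fun i => by
    refine sub_eq_zero.mp (hτ.faithful _ ?_)
    rw [← hvr' i]
    have : star (v i * (star (v i) * v i) - v i) * (v i * (star (v i) * v i) - v i)
        = r * r * r - r * r - (r * r - r) := by
      simp only [star_sub, star_mul, star_star, sub_mul, mul_sub, mul_assoc]
      simp only [← mul_assoc, hvr']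
    rw [this, (hep o).1, (hep o).1]
    simp [hr]
  have hev : ∀ i, e i * v i = v i := fun i => by rw [← hve, mul_assoc, hvr', hvr]
  have hvv : ∀ i j, star (v i) * v j = if i = j then r else 0 := fun i j => by
    split_ifs with h
    · rw [← h, hvr']
    · have h1 : star (v i) * e i = star (v i) := by
        have := congrArg star (hev i)
        rwa [star_mul, (hep i).2.star_eq] at this
      rw [← h1, ← hev j, mul_assoc, ← mul_assoc (e i), heo i j h]
      simp
  have hv1 : ∑ i, v i * star (v i) = 1 := by simp_rw [hve, hsum]
  have hcomm : ∀ b ∈ B, ∀ i, b * (v i * star (v i)) = v i * star (v i) * b := fun b hb i => by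
    rw [hve, hc _ hb _ (heB i)]
  have hc0 : ∀ i, c i i = 0 := fun i => by
    have := hcm i i
    rw [if_pos rfl] at this
    exact mul_self_eq_zero.mp this
  refine ⟨∑ i, ∑ j, c i j • (v i * star (v j)), isSelfAdjoint_sum_smul hcs,
    sum_smul_mul_self hvv hvr hv1 hcc,
    fun b hb => hτ.map_sum_smul_mul hvv hvr hc0 (hcomm b hb), fun a haB ha => ?_⟩
  rw [hτ.map_mul_sum_smul hvv hvr (hcomm a haB)]
  set w : ι → N := fun i => star (v i) * a * v i with hw
  have hae : ∀ i, τ (w i) = τ (e i * a) := fun i => by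
    rw [hw]
    beta_reduce
    rw [mul_assoc, hτ.tracial, mul_assoc, hve, hc _ haB _ (heB i)]
  have hw1 : ∑ i, τ (w i) = τ a := by
    simp_rw [hae]
    rw [← map_sum, ← Finset.sum_mul, hsum, one_mul]
  have hww : ∀ i, τ (w i * w i) = τ (e i * (a * a)) := fun i => by
    have h1 : w i * w i = star (v i) * (a * (e i * a) * v i) := by
      simp only [hw, ← hve, mul_assoc]
    have h2 : a * (e i * a) * e i = e i * (a * a) := by
      rw [hc _ (mul_mem haB (mul_mem (heB i) haB)) _ (heB i), hc _ haB _ (mul_mem (heB i) haB),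
        mul_assoc, ← mul_assoc, (hep i).1]
    rw [h1, hτ.tracial, mul_assoc, hve, h2]
  have hw2 : ∑ i, τ (w i * w i) = τ (a * a) := by
    simp_rw [hww]
    rw [← map_sum, ← Finset.sum_mul, hsum, one_mul]
  -- All the compressions e i a are transported under the same projection r and added there, so that
  -- τ(W) = τ(a).
  set W := ∑ i, w i with hWdef
  have hWs : star W = W := by
    rw [hWdef, star_sum]
    refine Finset.sum_congr rfl fun i _ => ?_
    simp only [hw, star_mul, star_star, ha.star_eq, mul_assoc]
  have hrW : r * W = W := by
    rw [hWdef, Finset.mul_sum]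
    refine Finset.sum_congr rfl fun i _ => ?_
    have : r * star (v i) = star (v i) := by
      have := congrArg star (hvr i)
      rwa [star_mul, (hep o).2.star_eq] at this
    simp only [hw, ← mul_assoc, this]
  -- Cauchy–Schwarz for τ(rW) = τ(a), where τ(r) = 2^-k.
  have hCS : 2 ^ k * (τ a).re ^ 2 ≤ (τ (W * W)).re := by
    have h1 := hτ.norm_map_mul_le' r W
    rw [hrW, hWdef, map_sum, hw1, ← hWdef] at h1
    have h2 := (Complex.abs_re_le_norm (τ a)).trans h1
    have h3 := pow_le_pow_left₀ (abs_nonneg _) h2 2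
    rw [mul_pow, hτ.l2Norm_sq, hτ.l2Norm_sq, (hep o).2.star_eq, (hep o).1, het, hWs, sq_abs] at h3
    calc 2 ^ k * (τ a).re ^ 2 ≤ 2 ^ k * ((2 ^ k)⁻¹ * (τ (W * W)).re) :=
          mul_le_mul_of_nonneg_left h3 h2k.le
      _ = _ := by rw [mul_inv_cancel_left₀ h2k.ne']
  have hmain : ∑ i, ∑ j, c i j * c j i * τ (w i * w j)
      = (((2 ^ k - 1 : ℝ)⁻¹ : ℝ) : ℂ) * (τ (W * W) - τ (a * a)) := by
    have h1 : τ (W * W) = ∑ i, ∑ j, τ (w i * w j) := by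
      rw [hWdef, Finset.sum_mul_sum]
      simp_rw [map_sum]
    rw [h1, ← hw2, ← Finset.sum_sub_distrib, Finset.mul_sum]
    refine Finset.sum_congr rfl fun i _ => ?_
    rw [← Finset.add_sum_erase _ _ (Finset.mem_univ i),
      ← Finset.add_sum_erase _ (fun j => τ (w i * w j)) (Finset.mem_univ i), hcm, if_pos rfl,
      zero_mul, zero_add, add_sub_cancel_left, Finset.mul_sum]
    refine Finset.sum_congr rfl fun j hj => ?_
    rw [hcm, if_neg (Finset.ne_of_mem_erase hj).symm]
  rw [hmain, Complex.re_ofReal_mul, Complex.sub_re]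
  have haa : 0 ≤ (τ (a * a)).re := by
    have := hτ.nonneg_re a
    rwa [ha.star_eq] at this
  set d : ℝ := 2 ^ k - 1 with hd
  -- Since 2^k = 1 + d, the bound contains τ(a)² with coefficient 1 + 1/d. The surplus τ(a)²/d is
  -- dropped below.
  have h5 : d⁻¹ * ((1 + d) * (τ a).re ^ 2 - (τ (a * a)).re)
      ≤ d⁻¹ * ((τ (W * W)).re - (τ (a * a)).re) := by
    refine mul_le_mul_of_nonneg_left ?_ (inv_nonneg.mpr hpos.le)
    have : 1 + d = 2 ^ k := by rw [hd]; ring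
    rw [this]
    linarith
  refine le_trans ?_ h5
  have h6 : d⁻¹ * d = 1 := inv_mul_cancel₀ hpos.ne'
  have h7 : d⁻¹ * ((1 + d) * (τ a).re ^ 2 - (τ (a * a)).re)
      = d⁻¹ * (τ a).re ^ 2 + (d⁻¹ * d) * (τ a).re ^ 2 - d⁻¹ * (τ (a * a)).re := by ring
  rw [h7, h6]
  have h8 := mul_le_mul_of_nonneg_right hk haa
  have h9 : 0 ≤ d⁻¹ * (τ a).re ^ 2 := mul_nonneg (inv_nonneg.mpr hpos.le) (sq_nonneg _)
  linarith

end Independence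

/-! ### Minimal projections and finite dimension. -/

section MinimalProjection

variable {N : Type*} [CStarAlgebra N] {τ : N →ₗ[ℂ] ℂ} {B : StarSubalgebra ℂ N}

/-- Elements `x i` such that the `x i * p` are partial isometries with common support `p` and
orthogonal ranges. -/
def IsOrthonormalAt (p : N) {n : ℕ} (x : Fin n → N) : Prop :=
  ∀ i j, p * (star (x i) * x j) * p = if i = j then p else 0

theorem IsOrthonormalAt.mul_eq {p : N} {n : ℕ} {x : Fin n → N}
    (hx : IsOrthonormalAt p x) (i j : Fin n) :
    x i * p * star (x i) * (x j * p * star (x j)) = if i = j then x i * p * star (x i) else 0 := by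
  calc _ = x i * (p * (star (x i) * x j) * p) * star (x j) := by simp only [mul_assoc]
    _ = _ := by
      rw [hx i j]
      split_ifs with h
      · rw [h]
      · simp

theorem IsOrthonormalAt.isStarProjection {p : N} (hp : IsStarProjection p) {n : ℕ} {x : Fin n → N}
    (hx : IsOrthonormalAt p x) : IsStarProjection (∑ i, x i * p * star (x i)) := by
  refine ⟨?_, ?_⟩
  · rw [IsIdempotentElem, Finset.sum_mul_sum]
    simp_rw [hx.mul_eq]
    simp
  · rw [IsSelfAdjoint, star_sum]
    refine Finset.sum_congr rfl fun i _ => ?_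
    simp only [star_mul, star_star, hp.2.star_eq, mul_assoc]

/-- The x i * p * star (x i) are n orthogonal projections, all of trace τ(p), with sum at most 1. -/
theorem IsOrthonormalAt.mul_re_le_one (hτ : IsFaithfulTracialState τ) {p : N}
    (hp : IsStarProjection p) {n : ℕ} {x : Fin n → N} (hx : IsOrthonormalAt p x) :
    n * (τ p).re ≤ 1 := by
  have h := hτ.re_nonneg (hx.isStarProjection hp).one_sub
  have h1 : ∀ i, τ (x i * p * star (x i)) = τ p := fun i => by
    have := hx i i
    rw [if_pos rfl] at this
    nth_rw 2 [← this]
    rw [mul_assoc, hτ.tracial (x i), hτ.tracial _ p, ← mul_assoc, ← mul_assoc, hp.1, mul_assoc]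
  rw [map_sub, map_sum, hτ.map_one, Complex.sub_re] at h
  simp_rw [h1] at h
  simpa using h

/-- Take a family orthonormal at p of maximal length, which exists because τ(p) > 0 bounds the
length. Its range projections add up to 1, for otherwise factoriality would supply one more member,
and then the finitely many x i p x j* span N. -/
theorem finiteDimensional_of_mul_mul_mem_span (hτ : IsFaithfulTracialState τ)
    (hF : ∀ z e : N, (∀ y, z * y * e = 0) → z = 0 ∨ e = 0) {p : N} (hp : IsStarProjection p)
    (hp0 : p ≠ 0) (h : ∀ y, ∃ c : ℂ, p * y * p = c • p) : FiniteDimensional ℂ N := by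
  have hpi : p * p = p := hp.1
  have hps : star p = p := hp.2
  have htp : 0 < (τ p).re :=
    (hτ.re_nonneg hp).lt_of_ne fun h0 => hp0 (hτ.eq_zero_of_re hp h0.symm)
  obtain ⟨n, ⟨x, hx⟩, hn⟩ : ∃ n : ℕ, (∃ x : Fin n → N, IsOrthonormalAt p x) ∧
      ¬ ∃ x : Fin (n + 1) → N, IsOrthonormalAt p x := by
    by_contra! hcon
    have hall : ∀ n : ℕ, ∃ x : Fin n → N, IsOrthonormalAt p x := fun n => by
      induction n with
      | zero => exact ⟨fun i => i.elim0, fun i => i.elim0⟩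
      | succ n ih =>
        obtain ⟨x, hx⟩ := ih
        exact hcon n ⟨x, hx⟩
    obtain ⟨n, hn⟩ := exists_nat_gt ((τ p).re)⁻¹
    obtain ⟨x, hx⟩ := hall n
    have h1 := hx.mul_re_le_one hτ hp
    have h2 := mul_lt_mul_of_pos_right hn htp
    rw [inv_mul_cancel₀ htp.ne'] at h2
    linarith
  set f := ∑ i, x i * p * star (x i) with hf
  have hfs : star f = f := (hx.isStarProjection hp).2
  have hfx : ∀ i, f * (x i * p) = x i * p := fun i => by
    rw [hf, Finset.sum_mul, Finset.sum_eq_single i]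
    · calc _ = x i * (p * (star (x i) * x i) * p) := by simp only [mul_assoc]
        _ = _ := by rw [hx i i, if_pos rfl]
    · intro j _ hj
      calc _ = x j * (p * (star (x j) * x i) * p) := by simp only [mul_assoc]
        _ = _ := by rw [hx j i, if_neg hj, mul_zero]
    · simp
  have hz : ∀ y, (1 - f) * y * p = 0 := by
    intro y
    by_contra hz0
    set z := (1 - f) * y * p with hzdef
    have hzp : z * p = z := by rw [hzdef, mul_assoc, hpi]
    have hpz : p * star z = star z := by
      have := congrArg star hzp
      rwa [star_mul, hps] at this
    have horth : ∀ i, p * (star (x i) * z) = 0 := fun i => by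
      have h1 := congrArg star (hfx i)
      rw [star_mul, star_mul, hfs, hps] at h1
      rw [hzdef, ← mul_assoc, ← mul_assoc, ← mul_assoc, mul_sub, h1]
      simp
    obtain ⟨c, hc⟩ := h (star z * z)
    have hc' : star z * z = c • p := by
      calc star z * z = p * star z * (z * p) := by rw [hpz, hzp]
        _ = c • p := by rw [← hc]; simp only [mul_assoc]
    have hτc : ((l2Norm τ z ^ 2 : ℝ) : ℂ) = c * ((τ p).re : ℂ) := by
      rw [hτ.ofReal_l2Norm_sq, hc', map_smul, smul_eq_mul]
      congr 1
      exact Complex.ext rfl (by simpa using hτ.im_eq_zero hp.2)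
    -- Since z*z = c p, taking traces shows c = d > 0. Hence z/√d prolongs the family.
    set d : ℝ := l2Norm τ z ^ 2 / (τ p).re with hd
    have hcd : c = (d : ℂ) := by
      have : ((τ p).re : ℂ) ≠ 0 := by exact_mod_cast htp.ne'
      rw [hd, Complex.ofReal_div, hτc, mul_div_cancel_right₀ _ this]
    have hd0 : 0 < d := by
      have : l2Norm τ z ≠ 0 := fun h0 => hz0 (hτ.eq_zero_of_l2Norm h0)
      have := (l2Norm_nonneg τ z).lt_of_ne this.symm
      positivity
    have hsd : ((√d : ℝ) : ℂ)⁻¹ * ((√d : ℝ) : ℂ)⁻¹ * c = 1 := by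
      rw [hcd, ← mul_inv, ← Complex.ofReal_mul, Real.mul_self_sqrt hd0.le]
      exact inv_mul_cancel₀ (by exact_mod_cast hd0.ne')
    have horth' : ∀ i, star z * x i * p = 0 := fun i => by
      have := congrArg star (horth i)
      rwa [star_mul, star_mul, star_star, hps, star_zero] at this
    refine hn ⟨Fin.snoc x (((√d : ℝ) : ℂ)⁻¹ • z), fun i j => ?_⟩
    refine Fin.lastCases ?_ (fun i => ?_) i <;> refine Fin.lastCases ?_ (fun j => ?_) j
    · rw [Fin.snoc_last, if_pos rfl, star_smul, smul_mul_smul_comm, hc', mul_smul_comm,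
        smul_mul_assoc, mul_smul_comm, smul_mul_assoc, hpi, hpi, smul_smul]
      rw [Complex.star_def, map_inv₀, Complex.conj_ofReal, hsd, one_smul]
    · rw [Fin.snoc_last, Fin.snoc_castSucc, if_neg (Fin.castSucc_lt_last j).ne', star_smul,
        smul_mul_assoc, mul_smul_comm, smul_mul_assoc, mul_assoc p, horth' j]
      simp
    · rw [Fin.snoc_last, Fin.snoc_castSucc, if_neg (Fin.castSucc_lt_last i).ne, mul_smul_comm,
        mul_smul_comm, smul_mul_assoc, horth i]
      simp
    · rw [Fin.snoc_castSucc, Fin.snoc_castSucc, hx i j]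
      simp
  have hf1 : f = 1 := by
    rcases hF (1 - f) p hz with h1 | h1
    · exact (sub_eq_zero.mp h1).symm
    · exact absurd h1 hp0
  classical
  refine ⟨⟨(Finset.univ : Finset (Fin n × Fin n)).image fun i => x i.1 * p * star (x i.2), ?_⟩⟩
  refine _root_.eq_top_iff.mpr fun y _ => ?_
  have hy : y = ∑ i, ∑ j, x i * (p * (star (x i) * y * x j) * p) * star (x j) := by
    calc y = f * y * f := by rw [hf1]; simp
      _ = _ := by
        rw [hf, Finset.sum_mul, Finset.sum_mul_sum]
        simp only [mul_assoc]
  rw [hy]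
  refine sum_mem fun i _ => sum_mem fun j _ => ?_
  obtain ⟨c, hc⟩ := h (star (x i) * y * x j)
  rw [hc, mul_smul_comm, smul_mul_assoc]
  exact Submodule.smul_mem _ _ (Submodule.subset_span
    (Finset.mem_coe.mpr (Finset.mem_image.mpr ⟨(i, j), Finset.mem_univ _, rfl⟩)))

/-- A maximal abelian subalgebra of an infinite dimensional finite factor is diffuse. -/
theorem hasNoMinimalProjections_of_maximal (hτ : IsFaithfulTracialState τ)
    (hR : HasRangeProjections B) (hB : IsClosed (B : Set N))
    (hc : ∀ x ∈ B, ∀ y ∈ B, x * y = y * x) (hmax : ∀ z, (∀ b ∈ B, z * b = b * z) → z ∈ B)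
    (hF : ∀ z e : N, (∀ y, z * y * e = 0) → z = 0 ∨ e = 0) (hN : ¬ FiniteDimensional ℂ N) :
    HasNoMinimalProjections B := by
  intro p hpB hp hp0
  by_contra! hmin
  -- For a projection q of B, minimality forces p q to be 0 or p; linear combinations of projections
  -- are norm dense in B.
  have hscal : ∀ b ∈ B, ∃ c : ℂ, p * b = c • p := by
    intro b hb
    have h := hR.mem_of_forall_projection hB
      ((Submodule.span ℂ {p}).comap (LinearMap.mulLeft ℂ p))
      ((Submodule.closed_of_finiteDimensional (Submodule.span ℂ {p})).preimage
        (continuous_const_mul p)) (fun q hqB hq => by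
        rw [Submodule.mem_comap, LinearMap.mulLeft_apply]
        by_cases h0 : p * q = 0
        · rw [h0]; exact zero_mem _
        · by_cases h1 : p * q = p
          · rw [h1]; exact Submodule.mem_span_singleton_self p
          · exact absurd (by rw [← mul_assoc, hp.1]) (hmin (p * q) (mul_mem hpB hqB)
              (hp.mul hq (hc _ hpB _ hqB)) h0 h1)) b hb
    rw [Submodule.mem_comap, LinearMap.mulLeft_apply, Submodule.mem_span_singleton] at h
    obtain ⟨c, hc⟩ := h
    exact ⟨c, hc.symm⟩
  refine hN (finiteDimensional_of_mul_mul_mem_span hτ hF hp hp0 fun y => ?_)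
  -- Elements of B act as scalars under p, so they commute with p y p. Maximality puts p y p in B,
  -- where it is again a multiple of p.
  have hyB : p * y * p ∈ B := by
    refine hmax _ fun b hb => ?_
    obtain ⟨c, hcb⟩ := hscal b hb
    rw [mul_assoc, hcb, ← mul_assoc b, ← mul_assoc b, hc _ hb _ hpB, hcb]
    simp only [mul_smul_comm, smul_mul_assoc]
  obtain ⟨c, hc'⟩ := hscal _ hyB
  exact ⟨c, by rw [← hc', ← mul_assoc, ← mul_assoc, hp.1]⟩

end MinimalProjection

/-! ### The tracial ultrapower and its paving size. -/

section UltrapowerTrace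

variable {N : Type*} [CStarAlgebra N] {τ : N →ₗ[ℂ] ℂ} {B : StarSubalgebra ℂ N}

/-- The trace is defined by `limUnder`; this identifies it as a genuine limit, and reduces
identities and inequalities in the ultrapower to limits of those in N. -/
theorem tendsto_ultraTrace (hτ : IsFaithfulTracialState τ) (ω : Ultrafilter ℕ)
    (x : boundedSeq N) :
    Tendsto (fun n => τ (x.1 n)) ω (𝓝 (ultraTrace hτ ω (ultraMk hτ ω x))) := by
  obtain ⟨z, hz⟩ := exists_tendsto hτ ω x
  have : ultraTrace hτ ω (ultraMk hτ ω x) = z := hz.limUnder_eq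
  rwa [this]

theorem ultraMk_surjective (hτ : IsFaithfulTracialState τ) (ω : Ultrafilter ℕ) :
    Function.Surjective (ultraMk hτ ω) :=
  Ideal.Quotient.mk_surjective

theorem ultraMk_eq_zero_iff (hτ : IsFaithfulTracialState τ) (ω : Ultrafilter ℕ)
    (x : boundedSeq N) :
    ultraMk hτ ω x = 0 ↔ Tendsto (fun n => l2Norm τ (x.1 n)) ω (𝓝 0) :=
  Ideal.Quotient.eq_zero_iff_mem

theorem tendsto_l2Norm_ultraMk (hτ : IsFaithfulTracialState τ) (ω : Ultrafilter ℕ)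
    (x : boundedSeq N) :
    Tendsto (fun n => l2Norm τ (x.1 n)) ω
      (𝓝 (l2Norm (ultraTrace hτ ω) (ultraMk hτ ω x))) := by
  have h := tendsto_ultraTrace hτ ω (star x * x)
  rw [map_mul, map_star] at h
  exact ((Complex.continuous_re.tendsto _).comp h).sqrt

theorem isFaithfulTracialState_ultraTrace (hτ : IsFaithfulTracialState τ) (ω : Ultrafilter ℕ) :
    IsFaithfulTracialState (ultraTrace hτ ω) := by
  have hsq : ∀ x : boundedSeq N, Tendsto (fun n => τ (star (x.1 n) * x.1 n)) ω
      (𝓝 (ultraTrace hτ ω (star (ultraMk hτ ω x) * ultraMk hτ ω x))) := fun x => by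
    have h := tendsto_ultraTrace hτ ω (star x * x)
    rwa [map_mul, map_star] at h
  refine ⟨fun a => ?_, fun a => ?_, ?_, fun a b => ?_, fun a ha => ?_⟩
  · obtain ⟨x, rfl⟩ := ultraMk_surjective hτ ω a
    exact ge_of_tendsto' ((Complex.continuous_re.tendsto _).comp (hsq x))
      fun n => hτ.nonneg_re (x.1 n)
  · obtain ⟨x, rfl⟩ := ultraMk_surjective hτ ω a
    refine tendsto_nhds_unique ((Complex.continuous_im.tendsto _).comp (hsq x)) ?_
    simp only [Function.comp_def, hτ.nonneg_im]
    exact tendsto_const_nhds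
  · have h := tendsto_ultraTrace hτ ω 1
    rw [map_one] at h
    refine tendsto_nhds_unique h ?_
    have : ∀ n, τ ((1 : boundedSeq N).1 n) = 1 := fun n => hτ.map_one
    simp only [this]
    exact tendsto_const_nhds
  · obtain ⟨x, rfl⟩ := ultraMk_surjective hτ ω a
    obtain ⟨y, rfl⟩ := ultraMk_surjective hτ ω b
    have h1 := tendsto_ultraTrace hτ ω (x * y)
    have h2 := tendsto_ultraTrace hτ ω (y * x)
    rw [map_mul] at h1 h2
    exact tendsto_nhds_unique h1 (h2.congr fun n => hτ.tracial _ _)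
  · obtain ⟨x, rfl⟩ := ultraMk_surjective hτ ω a
    rw [ultraMk_eq_zero_iff]
    have h := tendsto_l2Norm_ultraMk hτ ω x
    rwa [l2Norm, ha, Complex.zero_re, Real.sqrt_zero] at h

/-- The expectation of a class is obtained by taking bounded expectations termwise. -/
theorem isCondExp_ultraSubalgebra (hτ : IsFaithfulTracialState τ) (ω : Ultrafilter ℕ)
    (hW : HasWeakLimits τ B) (hB : IsClosed (B : Set N)) :
    IsCondExp (ultraTrace hτ ω) (ultraSubalgebra hτ ω B)
      (condExp (ultraTrace hτ ω) (ultraSubalgebra hτ ω B)) := by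
  refine (isFaithfulTracialState_ultraTrace hτ ω).isCondExp_condExp fun a => ?_
  obtain ⟨x, rfl⟩ := ultraMk_surjective hτ ω a
  choose y hyB hyn hy using fun n => hW.exists_expectation hτ hB (x.1 n)
  obtain ⟨C, hC⟩ := x.2
  let y' : boundedSeq N := ⟨y, 2 * C, fun n => (hyn n).trans (by linarith [hC n])⟩
  refine ⟨ultraMk hτ ω y', ⟨y', hyB, rfl⟩, ?_⟩
  rintro _ ⟨b, hb, rfl⟩
  have h1 := tendsto_ultraTrace hτ ω (y' * b)
  have h2 := tendsto_ultraTrace hτ ω (x * b)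
  rw [map_mul] at h1 h2
  exact tendsto_nhds_unique h1 (h2.congr fun n => (hy n _ (hb n)).symm)

/-- Elements of the ultrapower without expectation lift to sequences without expectation. -/
theorem exists_lift_of_condExp_eq_zero (hτ : IsFaithfulTracialState τ) (ω : Ultrafilter ℕ)
    (hW : HasWeakLimits τ B) (hB : IsClosed (B : Set N)) {a : Ultrapower hτ ω}
    (ha : condExp (ultraTrace hτ ω) (ultraSubalgebra hτ ω B) a = 0) :
    ∃ x : boundedSeq N, ultraMk hτ ω x = a ∧ ∀ n, ∀ b ∈ B, τ (x.1 n * b) = 0 := by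
  have hτω := isFaithfulTracialState_ultraTrace hτ ω
  have hE := isCondExp_ultraSubalgebra hτ ω hW hB
  obtain ⟨x, rfl⟩ := ultraMk_surjective hτ ω a
  choose y hyB hyn hy using fun n => hW.exists_expectation hτ hB (x.1 n)
  obtain ⟨C, hC⟩ := x.2
  let y' : boundedSeq N := ⟨y, 2 * C, fun n => (hyn n).trans (by linarith [hC n])⟩
  -- The class of the termwise expectations lies in the subalgebra and has the same pairings with it
  -- as a, namely zero. So it can be subtracted without changing a.
  have hy0 : ultraMk hτ ω y' = 0 := by
    refine hτω.faithful _ ?_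
    have hm : star (ultraMk hτ ω y') ∈ ultraSubalgebra hτ ω B :=
      star_mem (show ultraMk hτ ω y' ∈ ultraSubalgebra hτ ω B from ⟨y', hyB, rfl⟩)
    rw [hτω.tracial, ← (hE.eq_zero_iff hτω _).mp ha _ hm]
    have h1 := tendsto_ultraTrace hτ ω (y' * star y')
    have h2 := tendsto_ultraTrace hτ ω (x * star y')
    rw [map_mul, map_star] at h1 h2
    exact tendsto_nhds_unique h1 (h2.congr fun n => (hy n _ (star_mem (hyB n))).symm)
  refine ⟨x - y', by rw [map_sub, hy0, sub_zero], fun n b hb => ?_⟩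
  change τ ((x.1 n - y n) * b) = 0
  rw [sub_mul, map_sub, hy n b hb, sub_self]

/-- Upper bound for the paving size. -/
theorem isL2Pavable_ultrapower (hτ : IsFaithfulTracialState τ) {ω : Ultrafilter ℕ}
    (hω : (ω : Filter ℕ) ≤ cofinite) (hW : HasWeakLimits τ (⊤ : StarSubalgebra ℂ N))
    (hWB : HasWeakLimits τ B) (hR : HasRangeProjections B) (hB : IsClosed (B : Set N))
    (hc : ∀ x ∈ B, ∀ y ∈ B, x * y = y * x) (hmax : ∀ z, (∀ b ∈ B, z * b = b * z) → z ∈ B)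
    {ε : ℝ} (hε : 0 < ε) {n : ℕ} (hn : ε ^ (-2 : ℤ) ≤ n) {a : Ultrapower hτ ω}
    (ha : condExp (ultraTrace hτ ω) (ultraSubalgebra hτ ω B) a = 0) :
    IsL2Pavable (ultraTrace hτ ω) (ultraSubalgebra hτ ω B) ε n a := by
  obtain ⟨x, rfl, hx⟩ := exists_lift_of_condExp_eq_zero hτ ω hWB hB ha
  have hn0 : (0 : ℝ) < n := lt_of_lt_of_le (by positivity) hn
  -- The mth term is pinched to squared norm below 1/(m + 1) before merging into n classes.
  have hpav : ∀ m : ℕ, ∃ p : Fin n → N, IsPartition B p ∧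
      n * l2Norm τ (∑ i, p i * x.1 m * p i) ^ 2
        ≤ n * (1 / ((m : ℝ) + 1)) + l2Norm τ (x.1 m) ^ 2 := by
    intro m
    obtain ⟨k, q, hq, hlt⟩ := hW.exists_partition_l2Norm_lt hτ hR hB hc hmax (hx m)
      (δ := 1 / ((m : ℝ) + 1)) (by positivity)
    obtain ⟨p, hp, hle⟩ := hq.exists_merge hτ (Nat.cast_pos.mp hn0) (x.1 m)
    refine ⟨p, hp, hle.trans ?_⟩
    have := mul_le_mul_of_nonneg_left hlt.le hn0.le
    linarith
  choose p hp hle using hpav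
  let P : Fin n → boundedSeq N := fun i =>
    ⟨fun m => p m i, 1, fun m => ((hp m).isStarProjection i).norm_le⟩
  refine ⟨fun i => ultraMk hτ ω (P i), ⟨fun i => ⟨?_, ?_⟩, fun i => ?_, ?_⟩, ?_⟩
  · rw [IsIdempotentElem, ← map_mul]
    exact congrArg _ (Subtype.ext (funext fun m => ((hp m).isStarProjection i).1))
  · rw [IsSelfAdjoint, ← map_star]
    exact congrArg _ (Subtype.ext (funext fun m => ((hp m).isStarProjection i).2))
  · exact ⟨P i, fun m => (hp m).mem i, rfl⟩
  · rw [← map_sum, ← map_one (ultraMk hτ ω)]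
    refine congrArg _ (Subtype.ext (funext fun m => ?_))
    have : (∑ i, P i : boundedSeq N).1 m = ∑ i, p m i := by
      simp [P]
    rw [this, (hp m).sum_eq_one]
    rfl
  · have h1 := tendsto_l2Norm_ultraMk hτ ω (∑ i, P i * x * P i)
    have h2 := tendsto_l2Norm_ultraMk hτ ω x
    simp only [map_sum, map_mul] at h1
    have h3 : ∀ m, (∑ i, P i * x * P i : boundedSeq N).1 m = ∑ i, p m i * x.1 m * p m i := by
      intro m
      simp [P]
    -- Freeness of ω makes the error vanish in the limit.
    have hinv : Tendsto (fun m : ℕ => 1 / ((m : ℝ) + 1)) ω (𝓝 0) :=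
      tendsto_one_div_add_atTop_nhds_zero_nat.mono_left (Nat.cofinite_eq_atTop ▸ hω)
    have h4 := le_of_tendsto_of_tendsto' ((h1.pow 2).const_mul (n : ℝ))
      ((hinv.const_mul (n : ℝ)).add (h2.pow 2)) fun m => by rw [h3]; exact hle m
    rw [mul_zero, zero_add] at h4
    refine abs_le_of_sq_le_sq' ?_ (mul_nonneg hε.le (l2Norm_nonneg _ _)) |>.2
    set s := l2Norm (ultraTrace hτ ω) (ultraMk hτ ω x) ^ 2 with hs
    set t := l2Norm (ultraTrace hτ ω) (∑ i, ultraMk hτ ω (P i) * ultraMk hτ ω x *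
      ultraMk hτ ω (P i)) ^ 2 with ht
    have ht0 : 0 ≤ t := sq_nonneg _
    have hε2 : ε ^ (-2 : ℤ) * ε ^ 2 = 1 := by
      rw [zpow_neg, zpow_ofNat, inv_mul_cancel₀ (by positivity)]
    rw [mul_pow, ← hs]
    calc t = (ε ^ (-2 : ℤ) * t) * ε ^ 2 := by rw [mul_right_comm, hε2, one_mul]
      _ ≤ (n * t) * ε ^ 2 := by gcongr
      _ ≤ s * ε ^ 2 := by gcongr
      _ = ε ^ 2 * s := mul_comm _ _

/-- Almost `2`-independence passes from `B ⊂ N` to `B^ω ⊂ N^ω`. -/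
theorem exists_almost_independent_ultrapower (hτ : IsFaithfulTracialState τ) (ω : Ultrafilter ℕ)
    {x : N} {δ : ℝ} (hx : IsSelfAdjoint x) (hxx : x * x = 1) (hxB : ∀ b ∈ B, τ (x * b) = 0)
    (h : ∀ a ∈ B, IsSelfAdjoint a → (τ a).re ^ 2 - δ * (τ (a * a)).re ≤ (τ (a * x * a * x)).re) :
    ∃ y : Ultrapower hτ ω, IsSelfAdjoint y ∧ y * y = 1 ∧
      (∀ b ∈ ultraSubalgebra hτ ω B, ultraTrace hτ ω (y * b) = 0) ∧
      ∀ a ∈ ultraSubalgebra hτ ω B, IsSelfAdjoint a →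
        (ultraTrace hτ ω a).re ^ 2 - δ * (ultraTrace hτ ω (a * a)).re
          ≤ (ultraTrace hτ ω (a * y * a * y)).re := by
  let y : boundedSeq N := ⟨fun _ => x, ‖x‖, fun _ => le_rfl⟩
  have hys : star y = y := Subtype.ext (funext fun _ => hx.star_eq)
  have hyy : y * y = 1 := Subtype.ext (funext fun _ => hxx)
  refine ⟨ultraMk hτ ω y, ?_, ?_, ?_, ?_⟩
  · rw [IsSelfAdjoint, ← map_star, hys]
  · rw [← map_mul, hyy, map_one]
  · rintro _ ⟨b, hb, rfl⟩
    have h1 := tendsto_ultraTrace hτ ω (y * b)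
    rw [map_mul] at h1
    exact tendsto_nhds_unique h1 (tendsto_const_nhds.congr fun n => (hxB _ (hb n)).symm)
  · rintro _ ⟨b, hb, rfl⟩ hsa
    -- Symmetrisation gives a representative with self-adjoint terms, to which the inequality in N
    -- applies.
    let c : boundedSeq N := (2⁻¹ : ℂ) • (b + star b)
    have hc : ultraMk hτ ω c = ultraMk hτ ω b := by
      have hsa' : star (ultraMk hτ ω b) = ultraMk hτ ω b := hsa
      simp only [c]
      rw [map_smul, map_add, map_star, hsa', ← two_smul ℂ, smul_smul]
      norm_num
    have hcB : ∀ n, c.1 n ∈ B := fun n => B.smul_mem (add_mem (hb n) (star_mem (hb n))) _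
    have hcs : ∀ n, IsSelfAdjoint (c.1 n) := fun n => by
      change star ((2⁻¹ : ℂ) • (b.1 n + star (b.1 n))) = (2⁻¹ : ℂ) • (b.1 n + star (b.1 n))
      rw [star_smul, star_add, star_star, add_comm]
      simp
    change (ultraTrace hτ ω (ultraMk hτ ω b)).re ^ 2
      - δ * (ultraTrace hτ ω (ultraMk hτ ω b * ultraMk hτ ω b)).re
      ≤ (ultraTrace hτ ω (ultraMk hτ ω b * ultraMk hτ ω y * ultraMk hτ ω b * ultraMk hτ ω y)).re
    rw [← hc]
    have h1 := tendsto_ultraTrace hτ ω c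
    have h2 := tendsto_ultraTrace hτ ω (c * c)
    have h3 := tendsto_ultraTrace hτ ω (c * y * c * y)
    simp only [map_mul] at h2 h3
    have hre := Complex.continuous_re
    exact le_of_tendsto_of_tendsto' ((((hre.tendsto _).comp h1).pow 2).sub
      (((hre.tendsto _).comp h2).const_mul δ)) ((hre.tendsto _).comp h3)
      fun n => h _ (hcB n) (hcs n)

theorem exists_pos_mul_sq_add_lt_one {ε : ℝ} (hε : 0 < ε) {n : ℕ} (hn : (n : ℝ) < ε ^ (-2 : ℤ)) :
    ∃ δ : ℝ, 0 < δ ∧ n * (ε ^ 2 + δ) < 1 := by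
  have h1 : (n : ℝ) * ε ^ 2 < 1 := by
    have := mul_lt_mul_of_pos_right hn (pow_pos hε 2)
    rwa [zpow_neg, zpow_ofNat, inv_mul_cancel₀ (by positivity)] at this
  have hn1 : (0 : ℝ) < n + 1 := by positivity
  refine ⟨(1 - n * ε ^ 2) / (n + 1), div_pos (by linarith) hn1, ?_⟩
  have h2 : (n : ℝ) * ((1 - n * ε ^ 2) / (n + 1)) < 1 - n * ε ^ 2 := by
    rw [← mul_div_assoc, div_lt_iff₀ hn1]
    nlinarith
  rw [mul_add]
  linarith

/-- If m < ε⁻², an almost independent self-adjoint unitary of the ultrapower has 2-norm 1, while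
each of its pinchings by m projections has 2-norm above ε. -/
theorem ceil_le_of_forall_isL2Pavable_ultrapower (hτ : IsFaithfulTracialState τ) (ω : Ultrafilter ℕ)
    (hE : IsCondExp (ultraTrace hτ ω) (ultraSubalgebra hτ ω B)
      (condExp (ultraTrace hτ ω) (ultraSubalgebra hτ ω B)))
    (hB : ∀ δ : ℝ, 0 < δ → ∃ x : N, IsSelfAdjoint x ∧ x * x = 1 ∧ (∀ b ∈ B, τ (x * b) = 0) ∧
      ∀ a ∈ B, IsSelfAdjoint a → (τ a).re ^ 2 - δ * (τ (a * a)).re ≤ (τ (a * x * a * x)).re)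
    {ε : ℝ} (hε : 0 < ε) {m : ℕ}
    (hm : ∀ x : Ultrapower hτ ω, IsSelfAdjoint x →
      condExp (ultraTrace hτ ω) (ultraSubalgebra hτ ω B) x = 0 →
      IsL2Pavable (ultraTrace hτ ω) (ultraSubalgebra hτ ω B) ε m x) :
    ⌈ε ^ (-2 : ℤ)⌉₊ ≤ m := by
  have hτω := isFaithfulTracialState_ultraTrace hτ ω
  by_contra hlt
  rw [Nat.ceil_le, not_le] at hlt
  obtain ⟨δ, hδ0, hδn⟩ := exists_pos_mul_sq_add_lt_one hε hlt
  obtain ⟨x, hx, hxx, hxB, hxi⟩ := hB δ hδ0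
  obtain ⟨y, hys, hyy, hyB, hyi⟩ := exists_almost_independent_ultrapower hτ ω hx hxx hxB hxi
  obtain ⟨p, hp, hle⟩ := hm y hys ((hE.eq_zero_iff hτω y).mpr hyB)
  have h1 : l2Norm (ultraTrace hτ ω) y = 1 := by
    rw [l2Norm, hys.star_eq, hyy, hτω.map_one]
    simp
  rw [h1, mul_one] at hle
  exact absurd (hτω.lt_l2Norm_sum hys hδn hyi hp) (not_lt.mpr hle)

end UltrapowerTrace

end Paving

/-! ### The theorem. -/

open Paving

theorem proposition5p4 {H : Type*} [NormedAddCommGroup H] [InnerProductSpace ℂ H] [CompleteSpace H]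
    (M A : VonNeumannAlgebra H) (hM : IsIIOneFactor M) (hAM : A ≤ M) (hA : IsAbelian A)
    (τ : M.toStarSubalgebra →ₗ[ℂ] ℂ) (hτ : IsFaithfulTracialState τ)
    (hn : IsNormalFunctional M τ) :
    (IsDiffuse A →
      IsCondExp τ (subalgebraOf M A) (condExp τ (subalgebraOf M A)) ∧
      ∀ ε : ℝ, 0 < ε → ∀ n : ℕ, (n : ℝ) < ε ^ (-2 : ℤ) →
        ∃ x : M.toStarSubalgebra, IsSelfAdjoint x ∧ x ∈ unitary M.toStarSubalgebra ∧
          condExp τ (subalgebraOf M A) x = 0 ∧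
          ∀ p : Fin n → M.toStarSubalgebra, IsPartition (subalgebraOf M A) p →
            l2Norm τ (∑ k, p k * x * p k) ≤ ‖∑ k, p k * x * p k‖ ∧
            ε < l2Norm τ (∑ k, p k * x * p k)) ∧
    (IsMASA M A → ∀ ω : Ultrafilter ℕ, (ω : Filter ℕ) ≤ Filter.cofinite →
      IsCondExp (ultraTrace hτ ω) (ultraSubalgebra hτ ω (subalgebraOf M A))
        (condExp (ultraTrace hτ ω) (ultraSubalgebra hτ ω (subalgebraOf M A))) ∧
      ∀ ε : ℝ, 0 < ε →
        IsUniformL2PavingSize (ultraTrace hτ ω) (ultraSubalgebra hτ ω (subalgebraOf M A))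
          Set.univ ε ⌈ε ^ (-2 : ℤ)⌉₊ ∧
        IsUniformL2PavingSize (ultraTrace hτ ω) (ultraSubalgebra hτ ω (subalgebraOf M A))
          {x | IsSelfAdjoint x} ε ⌈ε ^ (-2 : ℤ)⌉₊) := by
  have hW : HasWeakLimits τ (⊤ : StarSubalgebra ℂ M.toStarSubalgebra) :=
    subalgebraOf_self M ▸ hn.hasWeakLimits
  have hR : HasRangeProjections (⊤ : StarSubalgebra ℂ M.toStarSubalgebra) :=
    subalgebraOf_self M ▸ hasRangeProjections_subalgebraOf le_rfl
  have hWA : HasWeakLimits τ (subalgebraOf M A) := hn.hasWeakLimits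
  have hRA := hasRangeProjections_subalgebraOf hAM
  have hcl := isClosed_subalgebraOf M A
  have hF : ∀ z e : M.toStarSubalgebra, (∀ y, z * y * e = 0) → z = 0 ∨ e = 0 :=
    fun z e h => hM.eq_zero_or_eq_zero h
  have hc : ∀ x ∈ subalgebraOf M A, ∀ y ∈ subalgebraOf M A, x * y = y * x :=
    fun x hx y hy => Subtype.ext (hA _ hx _ hy)
  refine ⟨fun hdiff => ?_, fun hmasa ω hω => ?_⟩
  · have hD : HasNoMinimalProjections (subalgebraOf M A) := by
      intro p hp hpp hp0
      obtain ⟨q, hqA, hq, hq0, hqp, hpq⟩ := hdiff p hp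
        ⟨congrArg Subtype.val hpp.1, congrArg Subtype.val hpp.2⟩ fun h => hp0 (Subtype.ext h)
      exact ⟨⟨q, hAM hqA⟩, hqA, ⟨Subtype.ext hq.1, Subtype.ext hq.2⟩,
        fun h => hq0 (congrArg Subtype.val h), fun h => hqp (congrArg Subtype.val h),
        Subtype.ext hpq⟩
    have hE : IsCondExp τ (subalgebraOf M A) (condExp τ (subalgebraOf M A)) :=
      hτ.isCondExp_condExp fun x =>
        let ⟨y, hy, _, h⟩ := hWA.exists_expectation hτ hcl x
        ⟨y, hy, h⟩
    refine ⟨hE, fun ε hε n hnε => ?_⟩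
    obtain ⟨δ, hδ0, hδn⟩ := exists_pos_mul_sq_add_lt_one hε hnε
    obtain ⟨x, hx, hxx, hxA, hxi⟩ := hD.exists_almost_independent hτ hW hWA hR hF hc hδ0
    refine ⟨x, hx, ?_, (hE.eq_zero_iff hτ x).mpr hxA, fun p hp => ⟨?_, ?_⟩⟩
    · rw [Unitary.mem_iff, hx.star_eq]
      exact ⟨hxx, hxx⟩
    · have h := hτ.l2Norm_mul_left (∑ k, p k * x * p k) 1
      have h1 : l2Norm τ (1 : M.toStarSubalgebra) = 1 := by simp [l2Norm, hτ.map_one]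
      rwa [mul_one, h1, mul_one] at h
    · exact hτ.lt_l2Norm_sum hx hδn hxi hp
  · have hmax : ∀ z : M.toStarSubalgebra, (∀ b ∈ subalgebraOf M A, z * b = b * z) →
        z ∈ subalgebraOf M A := fun z hz => hmasa.mem_of_commute hz
    have hD : HasNoMinimalProjections (subalgebraOf M A) :=
      hasNoMinimalProjections_of_maximal hτ hRA hcl hc hmax hF hM.infinite_dim
    have hE := isCondExp_ultraSubalgebra hτ ω hWA hcl
    refine ⟨hE, fun ε hε => ?_⟩
    -- The obstruction to paving is self-adjoint, so the same lower bound serves all elements and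
    -- the self-adjoint ones.
    have hlow : ∀ m : ℕ, (∀ x : Ultrapower hτ ω, IsSelfAdjoint x →
        condExp (ultraTrace hτ ω) (ultraSubalgebra hτ ω (subalgebraOf M A)) x = 0 →
        IsL2Pavable (ultraTrace hτ ω) (ultraSubalgebra hτ ω (subalgebraOf M A)) ε m x) →
        ⌈ε ^ (-2 : ℤ)⌉₊ ≤ m := fun m hm =>
      ceil_le_of_forall_isL2Pavable_ultrapower hτ ω hE
        (fun δ hδ => hD.exists_almost_independent hτ hW hWA hR hF hc hδ) hε hm
    exact ⟨⟨fun x _ hx => isL2Pavable_ultrapower hτ hω hW hWA hRA hcl hc hmax hε (Nat.le_ceil _) hx,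
        fun m hm => hlow m fun x _ hx => hm x (Set.mem_univ _) hx⟩,
      ⟨fun x _ hx => isL2Pavable_ultrapower hτ hω hW hWA hRA hcl hc hmax hε (Nat.le_ceil _) hx,
        fun m hm => hlow m fun x hxs hx => hm x hxs hx⟩⟩
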